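/- Let $(N,g)$ be a smooth finite-dimensional Riemannian manifold without boundary, let $\varrho:\mathbb R\to(0,\infty)$ be smooth, and let $\bar M=\mathbb R\times_\varrho N$ be the warped product, i.e. the manifold $\mathbb R\times N$ with the Riemannian metric $dt^2+\varrho(t)^2 g$ and Levi-Civita connection $\bar\nabla$. Let $F:N\to\mathbb R$ be a transnormal function, that is, a function of class $C^2$ such that $|\nabla F|=b\circ F$ on $N$ for some function $b:\mathbb R\to[0,\infty)$ (no regularity of $b$ is assumed). Then the graph $M=\{(F(x),x): x\in N\}$ has a canonical principal direction relative to the vector field $\partial_t$. Precisely: $M$ is an embedded $C^2$ hypersurface of $\bar M$ which admits a $C^1$ unit normal vector field, and for every $C^1$ unit normal vector field $\xi$ of $M$ and every point $p\in M$ at which the tangential projection $\partial_t^{T}=\partial_t-\langle\partial_t,\xi\rangle\,\xi$ is non-zero, $\partial_t^{T}(p)$ is a principal direction of $M$ at $p$, i.e. an eigenvector of the shape operator $A_\xi Y=-\bar\nabla_Y\xi$ of $M$ at $p$. -/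

import Mathlib

open Bundle Manifold
open scoped ContDiff

noncomputable section

namespace CanonicalDirection

section Riemannian

variable {E : Type*} [NormedAddCommGroup E] [NormedSpace ℝ E]
  {H : Type*} [TopologicalSpace H] {I : ModelWithCorners ℝ E H}
  {M : Type*} [TopologicalSpace M] [ChartedSpace H M] [IsManifold I ∞ M]

variable (I M) in
/-- A smooth Riemannian metric on the manifold `M`. -/
abbrev Metric := ContMDiffRiemannianMetric I ∞ E (fun x : M => TangentSpace I x)

/-- The musical isomorphism `v ↦ ⟨v, ·⟩` from the tangent space at `x` onto its dual. -/
def flat [FiniteDimensional ℝ E] (g : Metric I M) (x : M) :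
    TangentSpace I x ≃ₗ[ℝ] (TangentSpace I x →L[ℝ] ℝ) :=
  haveI : FiniteDimensional ℝ (TangentSpace I x) := inferInstanceAs (FiniteDimensional ℝ E)
  haveI : FiniteDimensional ℝ (TangentSpace I x →L[ℝ] ℝ) :=
    inferInstanceAs (FiniteDimensional ℝ (E →L[ℝ] ℝ))
  LinearMap.linearEquivOfInjective (g.inner x).toLinearMap
    (by
      rw [← LinearMap.ker_eq_bot, LinearMap.ker_eq_bot']
      intro v hv
      by_contra h
      have h1 := g.pos x v h
      have h2 : g.inner x v v = 0 := by
        have := congrArg (fun φ : TangentSpace I x →L[ℝ] ℝ => φ v) hv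
        simpa using this
      linarith)
    (by
      change Module.finrank ℝ E = Module.finrank ℝ (E →L[ℝ] ℝ)
      rw [← (LinearMap.toContinuousLinearMap (𝕜 := ℝ) (E := E) (F' := ℝ)).finrank_eq]
      exact (Subspace.dual_finrank_eq (K := ℝ) (V := E)).symm)

theorem flat_apply [FiniteDimensional ℝ E] (g : Metric I M) (x : M) (v w : TangentSpace I x) :
    flat g x v w = g.inner x v w := rfl

/-- The length of a tangent vector. -/
def length (g : Metric I M) (x : M) (v : TangentSpace I x) : ℝ := Real.sqrt (g.inner x v v)

/-- The gradient of a function: the vector field dual to its differential. -/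
def gradient [FiniteDimensional ℝ E] (g : Metric I M) (F : M → ℝ) (x : M) : TangentSpace I x :=
  (flat g x).symm (mvfderiv I F x)

theorem inner_gradient [FiniteDimensional ℝ E] (g : Metric I M) (F : M → ℝ) (x : M)
    (v : TangentSpace I x) : g.inner x (gradient g F x) v = mvfderiv I F x v := by
  rw [← flat_apply, gradient, LinearEquiv.apply_symm_apply]

/-- The generalized eikonal equation `|∇F| = b ∘ F` with a non-negative function `b`. -/
def IsTransnormal [FiniteDimensional ℝ E] (g : Metric I M) (F : M → ℝ) : Prop :=
  ∃ b : ℝ → ℝ, (∀ s, 0 ≤ b s) ∧ ∀ x, length g x (gradient g F x) = b (F x)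

/-! ### The Levi-Civita connection, in the preferred chart at each point -/

/-- The components of the metric near `x₀` in the chart centred at `x₀`, see
`coordMetric_apply`. -/
def coordMetric (g : Metric I M) (x₀ x : M) : E →L[ℝ] E →L[ℝ] ℝ :=
  ContinuousLinearMap.inCoordinates E (TangentSpace I (M := M)) (E →L[ℝ] ℝ)
    (fun y : M => TangentSpace I y →L[ℝ] ℝ) x₀ x x₀ x (g.inner x)

/-- `coordMetric g x₀ x v w` is the inner product at `x` of the constant-coefficient fields with
coefficients `v` and `w` in the chart at `x₀`. -/
theorem coordMetric_apply (g : Metric I M) {x₀ x : M}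
    (hx : x ∈ (trivializationAt E (TangentSpace I (M := M)) x₀).baseSet) (v w : E) :
    coordMetric g x₀ x v w =
      g.inner x ((trivializationAt E (TangentSpace I (M := M)) x₀).symm x v)
        ((trivializationAt E (TangentSpace I (M := M)) x₀).symm x w) := by
  rw [coordMetric, inCoordinates_apply_eq₂ hx hx (Set.mem_univ _)]
  simp

/-- The derivative at `x` of the components of the metric in the chart at `x`. -/
def coordMetricDeriv (g : Metric I M) (x : M) : E →L[ℝ] E →L[ℝ] E →L[ℝ] ℝ :=
  (mvfderiv I (coordMetric g x) x : TangentSpace I x →L[ℝ] E →L[ℝ] E →L[ℝ] ℝ)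

/-- The Christoffel symbols of the first kind at `x` in the chart at `x`, as the covector
`z ↦ (1/2) (∂_v g(w, z) + ∂_w g(v, z) - ∂_z g(v, w))`. -/
def christoffelFirst (g : Metric I M) (x : M) (v w : E) : E →L[ℝ] ℝ :=
  (1 / 2 : ℝ) • (coordMetricDeriv g x v w + coordMetricDeriv g x w v
    - ((coordMetricDeriv g x).flip v).flip w)

theorem christoffelFirst_apply (g : Metric I M) (x : M) (v w z : E) :
    christoffelFirst g x v w z = (1 / 2 : ℝ) * (coordMetricDeriv g x v w z
      + coordMetricDeriv g x w v z - coordMetricDeriv g x z v w) := rfl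

/-- The Christoffel symbols of the second kind at `x` in the chart at `x`. The trivialization at
`x` of the tangent bundle is the identity `TangentSpace I x = E` on the fibre over `x`. -/
def christoffel [FiniteDimensional ℝ E] (g : Metric I M) (x : M) (v w : TangentSpace I x) :
    TangentSpace I x :=
  (flat g x).symm (christoffelFirst g x v w : E →L[ℝ] ℝ)

/-! ### Vector fields along a map, hypersurfaces and principal directions -/

variable {E' : Type*} [NormedAddCommGroup E'] [NormedSpace ℝ E']
  {H' : Type*} [TopologicalSpace H'] {I' : ModelWithCorners ℝ E' H'}
  {S : Type*} [TopologicalSpace S] [ChartedSpace H' S]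

variable (I') in
/-- The Levi-Civita covariant derivative `∇_v V` at `p` of a vector field `V` along a map
`f : S → M`: in coordinates at `f p`, it is `∂_v V^k + Γ^k_{ij} (df v)^i V^j`. -/
def covDerivAlong [FiniteDimensional ℝ E] (g : Metric I M) (f : S → M)
    (V : ∀ p : S, TangentSpace I (f p)) (p : S) (v : TangentSpace I' p) :
    TangentSpace I (f p) :=
  (trivializationAt E (TangentSpace I (M := M)) (f p)).symm (f p)
      (mvfderiv I' (fun q => ((trivializationAt E (TangentSpace I (M := M)) (f p))
        (⟨f q, V q⟩ : TangentBundle I M)).2) p v)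
    + christoffel g (f p) (mfderiv I' I f p v) (V p)

variable (I I') in
/-- `f` parametrizes an embedded hypersurface of class `C^2`. -/
structure IsHypersurface (f : S → M) : Prop where
  contMDiff : ContMDiff I' I 2 f
  isEmbedding : Topology.IsEmbedding f
  injective_mfderiv : ∀ p, Function.Injective (mfderiv I' I f p)
  codim_one : Module.finrank ℝ E = Module.finrank ℝ E' + 1

variable (I') in
/-- `ξ` is a unit normal vector field, of class `C^1`, of the hypersurface parametrized by `f`. -/
structure IsUnitNormal (g : Metric I M) (f : S → M) (ξ : ∀ p : S, TangentSpace I (f p)) :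
    Prop where
  contMDiff : ContMDiff I' I.tangent 1 (fun p => (⟨f p, ξ p⟩ : TangentBundle I M))
  unit : ∀ p, g.inner (f p) (ξ p) (ξ p) = 1
  normal : ∀ (p : S) (v : TangentSpace I' p), g.inner (f p) (ξ p) (mfderiv I' I f p v) = 0

/-- The projection `X - ⟨X, ξ⟩ ξ` of `X` onto the tangent space of the hypersurface. -/
def tangentPart (g : Metric I M) (f : S → M) (ξ : ∀ p : S, TangentSpace I (f p))
    (X : ∀ x : M, TangentSpace I x) (p : S) : TangentSpace I (f p) :=
  X (f p) - g.inner (f p) (X (f p)) (ξ p) • ξ p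

variable (I') in
/-- `w` is a principal direction at `f p`: a nonzero tangent vector of the hypersurface which is
an eigenvector of the shape operator `A_ξ Y = -∇_Y ξ`. -/
def IsPrincipalDirection [FiniteDimensional ℝ E] (g : Metric I M) (f : S → M)
    (ξ : ∀ p : S, TangentSpace I (f p)) (p : S) (w : TangentSpace I (f p)) : Prop :=
  w ≠ 0 ∧ ∃ u : TangentSpace I' p, mfderiv I' I f p u = w ∧
    ∃ c : ℝ, -covDerivAlong I' g f ξ p u = c • w

variable (I') in
/-- The map `f` parametrizes an orientable hypersurface with a canonical principal direction
relative to `X`: the tangential projection of `X` is a principal direction at every point where it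
does not vanish. -/
def HasCanonicalPrincipalDirection [FiniteDimensional ℝ E] (g : Metric I M) (f : S → M)
    (X : ∀ x : M, TangentSpace I x) : Prop :=
  IsHypersurface I I' f ∧ (∃ ξ, IsUnitNormal I' g f ξ) ∧
    ∀ ξ, IsUnitNormal I' g f ξ → ∀ p, tangentPart g f ξ X p ≠ 0 →
      IsPrincipalDirection I' g f ξ p (tangentPart g f ξ X p)

end Riemannian

section Warped

variable {E : Type*} [NormedAddCommGroup E] [NormedSpace ℝ E]
  {N : Type*} [TopologicalSpace N] [ChartedSpace E N] [IsManifold 𝓘(ℝ, E) ∞ N]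

/-- The scalar product `dt² + ρ(t)² g` on the tangent space of `ℝ × N` at `z = (t, x)`. -/
def warpedInner (ρ : ℝ → ℝ) (g : Metric 𝓘(ℝ, E) N) (z : ℝ × N) :
    TangentSpace (𝓘(ℝ, ℝ).prod 𝓘(ℝ, E)) z →L[ℝ]
      TangentSpace (𝓘(ℝ, ℝ).prod 𝓘(ℝ, E)) z →L[ℝ] ℝ :=
  letI G : E →L[ℝ] E →L[ℝ] ℝ := g.inner z.2
  ((ContinuousLinearMap.mul ℝ ℝ).bilinearComp (ContinuousLinearMap.fst ℝ ℝ E)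
      (ContinuousLinearMap.fst ℝ ℝ E)
    + (ρ z.1) ^ 2 • G.bilinearComp (ContinuousLinearMap.snd ℝ ℝ E)
      (ContinuousLinearMap.snd ℝ ℝ E) : ℝ × E →L[ℝ] ℝ × E →L[ℝ] ℝ)

theorem warpedInner_apply (ρ : ℝ → ℝ) (g : Metric 𝓘(ℝ, E) N) (z : ℝ × N)
    (v w : TangentSpace (𝓘(ℝ, ℝ).prod 𝓘(ℝ, E)) z) :
    warpedInner ρ g z v w = v.1 * w.1 + ρ z.1 ^ 2 * g.inner z.2 v.2 w.2 := rfl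

theorem warpedInner_pos {ρ : ℝ → ℝ} (hpos : ∀ t, 0 < ρ t) (g : Metric 𝓘(ℝ, E) N) (z : ℝ × N)
    (v : TangentSpace (𝓘(ℝ, ℝ).prod 𝓘(ℝ, E)) z) (hv : v ≠ 0) : 0 < warpedInner ρ g z v v := by
  rw [warpedInner_apply]
  have hρ : 0 < ρ z.1 ^ 2 := by have := hpos z.1; positivity
  by_cases h : (v.2 : E) = 0
  · have h1 : (v.1 : ℝ) ≠ 0 := fun h1 => hv (Prod.ext h1 h)
    have h2 : g.inner z.2 v.2 v.2 = 0 := by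
      have : g.inner z.2 (v.2 : E) = 0 := by rw [h]; exact map_zero _
      rw [this]; rfl
    rw [h2]
    have := mul_self_pos.2 h1
    linarith
  · have h2 : 0 < g.inner z.2 v.2 v.2 := g.pos z.2 v.2 h
    have := mul_self_nonneg (v.1 : ℝ)
    have := mul_pos hρ h2
    linarith

theorem warpedInner_isVonNBounded {ρ : ℝ → ℝ} (hpos : ∀ t, 0 < ρ t) (g : Metric 𝓘(ℝ, E) N)
    (z : ℝ × N) : Bornology.IsVonNBounded ℝ
      {v : TangentSpace (𝓘(ℝ, ℝ).prod 𝓘(ℝ, E)) z | warpedInner ρ g z v v < 1} := by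
  have h1 := g.isVonNBounded z.2
  change Bornology.IsVonNBounded ℝ {v : E | g.inner z.2 v v < 1} at h1
  rw [NormedSpace.isVonNBounded_iff] at h1
  obtain ⟨C, hC⟩ := h1.exists_norm_le
  change Bornology.IsVonNBounded ℝ {v : ℝ × E | warpedInner ρ g z v v < 1}
  rw [NormedSpace.isVonNBounded_iff, isBounded_iff_forall_norm_le]
  refine ⟨max 1 ((ρ z.1)⁻¹ * C), fun v hv => ?_⟩
  have hρ := hpos z.1
  have hv' : v.1 * v.1 + ρ z.1 ^ 2 * g.inner z.2 v.2 v.2 < 1 := hv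
  have h2 : 0 ≤ g.inner z.2 v.2 v.2 := by
    by_cases h : v.2 = 0
    · have : g.inner z.2 v.2 = 0 := by rw [h]; exact map_zero _
      rw [this]; exact le_rfl
    · exact (g.pos z.2 v.2 h).le
  have h3 : ‖v.1‖ ≤ 1 := by
    rw [Real.norm_eq_abs, abs_le_one_iff_mul_self_le_one]
    nlinarith [mul_nonneg (sq_nonneg (ρ z.1)) h2]
  have h4 : ‖ρ z.1 • v.2‖ ≤ C := by
    apply hC
    have e1 : g.inner z.2 (ρ z.1 • v.2 : E) = ρ z.1 • g.inner z.2 v.2 :=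
      map_smul (g.inner z.2) (ρ z.1) (v.2 : TangentSpace 𝓘(ℝ, E) z.2)
    have e2 : g.inner z.2 v.2 (ρ z.1 • v.2 : E) = ρ z.1 • g.inner z.2 v.2 v.2 :=
      map_smul (g.inner z.2 v.2) (ρ z.1) (v.2 : TangentSpace 𝓘(ℝ, E) z.2)
    have e3 : g.inner z.2 (ρ z.1 • v.2 : E) (ρ z.1 • v.2 : E)
        = ρ z.1 * (ρ z.1 * g.inner z.2 v.2 v.2) := by
      rw [e1]
      change ρ z.1 * g.inner z.2 v.2 (ρ z.1 • v.2 : E) = _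
      rw [e2]; rfl
    change g.inner z.2 (ρ z.1 • v.2 : E) (ρ z.1 • v.2 : E) < 1
    rw [e3]
    nlinarith [mul_self_nonneg v.1]
  rw [norm_smul, Real.norm_eq_abs, abs_of_pos hρ] at h4
  rw [Prod.norm_def]
  refine max_le (h3.trans (le_max_left _ _)) (le_trans ?_ (le_max_right _ _))
  rwa [le_inv_mul_iff₀ hρ]

theorem warpedInner_contMDiff {ρ : ℝ → ℝ} (hρ : ContDiff ℝ ∞ ρ) (g : Metric 𝓘(ℝ, E) N) :
    ContMDiff (𝓘(ℝ, ℝ).prod 𝓘(ℝ, E))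
      ((𝓘(ℝ, ℝ).prod 𝓘(ℝ, E)).prod 𝓘(ℝ, (ℝ × E) →L[ℝ] (ℝ × E) →L[ℝ] ℝ)) ∞
      (fun z : ℝ × N => TotalSpace.mk' ((ℝ × E) →L[ℝ] (ℝ × E) →L[ℝ] ℝ)
        (E := fun z : ℝ × N => TangentSpace (𝓘(ℝ, ℝ).prod 𝓘(ℝ, E)) z →L[ℝ]
          TangentSpace (𝓘(ℝ, ℝ).prod 𝓘(ℝ, E)) z →L[ℝ] ℝ) z (warpedInner ρ g z)) := by
  intro z₀
  rw [contMDiffAt_hom_bundle]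
  refine ⟨contMDiffAt_id, ?_⟩
  have hA := (contMDiffAt_fst (I := 𝓘(ℝ, ℝ)) (J := 𝓘(ℝ, E)) (n := ∞)
    (p := z₀)).mfderiv_const (m := ∞) (by simp)
  have hB := (contMDiffAt_snd (I := 𝓘(ℝ, ℝ)) (J := 𝓘(ℝ, E)) (n := ∞)
    (p := z₀)).mfderiv_const (m := ∞) (by simp)
  have hg : ContMDiffAt (𝓘(ℝ, ℝ).prod 𝓘(ℝ, E)) 𝓘(ℝ, E →L[ℝ] E →L[ℝ] ℝ) ∞
      (fun z : ℝ × N => coordMetric g z₀.2 z.2) z₀ := by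
    have h := g.contMDiff z₀.2
    rw [contMDiffAt_hom_bundle] at h
    exact h.2.comp z₀ contMDiffAt_snd
  have hr : ContMDiffAt (𝓘(ℝ, ℝ).prod 𝓘(ℝ, E)) 𝓘(ℝ, ℝ) ∞ (fun z : ℝ × N => ρ z.1 ^ 2) z₀ :=
    ((hρ.pow 2).contMDiff.contMDiffAt).comp z₀ contMDiffAt_fst
  set A : ℝ × N → (ℝ × E →L[ℝ] ℝ) := inTangentCoordinates (𝓘(ℝ, ℝ).prod 𝓘(ℝ, E)) 𝓘(ℝ, ℝ) id
    Prod.fst (mfderiv (𝓘(ℝ, ℝ).prod 𝓘(ℝ, E)) 𝓘(ℝ, ℝ) (Prod.fst : ℝ × N → ℝ)) z₀ with hAdef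
  set B : ℝ × N → (ℝ × E →L[ℝ] E) := inTangentCoordinates (𝓘(ℝ, ℝ).prod 𝓘(ℝ, E)) 𝓘(ℝ, E) id
    Prod.snd (mfderiv (𝓘(ℝ, ℝ).prod 𝓘(ℝ, E)) 𝓘(ℝ, E) (Prod.snd : ℝ × N → N)) z₀ with hBdef
  have hA' := hA.clm_precomp (F₃ := ℝ)
  have hB' := hB.clm_precomp (F₃ := ℝ)
  have hmul : ContMDiffAt (𝓘(ℝ, ℝ).prod 𝓘(ℝ, E)) 𝓘(ℝ, ℝ →L[ℝ] ℝ →L[ℝ] ℝ) ∞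
    (fun _ : ℝ × N => ContinuousLinearMap.mul ℝ ℝ) z₀ := contMDiffAt_const
  have key := (hA'.clm_comp (hmul.clm_comp hA)).add (hr.smul (hB'.clm_comp (hg.clm_comp hB)))
  refine key.congr_of_eventuallyEq ?_
  have hev : ∀ᶠ z in nhds z₀, z ∈ (trivializationAt (ℝ × E)
      (TangentSpace (𝓘(ℝ, ℝ).prod 𝓘(ℝ, E)) (M := ℝ × N)) z₀).baseSet :=
    (trivializationAt (ℝ × E) (TangentSpace (𝓘(ℝ, ℝ).prod 𝓘(ℝ, E)) (M := ℝ × N))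
      z₀).open_baseSet.mem_nhds (FiberBundle.mem_baseSet_trivializationAt' z₀)
  have hev2 : ∀ᶠ z : ℝ × N in nhds z₀, z.2 ∈ (trivializationAt E
      (TangentSpace 𝓘(ℝ, E) (M := N)) z₀.2).baseSet :=
    continuous_snd.continuousAt.preimage_mem_nhds
      ((trivializationAt E (TangentSpace 𝓘(ℝ, E) (M := N)) z₀.2).open_baseSet.mem_nhds
        (FiberBundle.mem_baseSet_trivializationAt' z₀.2))
  filter_upwards [hev, hev2] with z hz hz2
  refine ContinuousLinearMap.ext fun v => ContinuousLinearMap.ext fun w => ?_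
  rw [inCoordinates_apply_eq₂ hz hz (Set.mem_univ _)]
  have eA : ∀ v : ℝ × E, A z v = ((trivializationAt (ℝ × E)
      (TangentSpace (𝓘(ℝ, ℝ).prod 𝓘(ℝ, E)) (M := ℝ × N)) z₀).symm z v).1 := by
    intro v
    change (trivializationAt ℝ (TangentSpace 𝓘(ℝ, ℝ) (M := ℝ)) z₀.1).continuousLinearMapAt ℝ z.1
      (mfderiv (𝓘(ℝ, ℝ).prod 𝓘(ℝ, E)) 𝓘(ℝ, ℝ) (Prod.fst : ℝ × N → ℝ) z
        ((trivializationAt (ℝ × E) (TangentSpace (𝓘(ℝ, ℝ).prod 𝓘(ℝ, E)) (M := ℝ × N)) z₀).symmL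
          ℝ z v)) = _
    rw [TangentBundle.continuousLinearMapAt_model_space, mfderiv_fst,
      ← Trivialization.symmL_apply (R := ℝ) _ hz]
    rfl
  have eB : ∀ v : ℝ × E, (trivializationAt E (TangentSpace 𝓘(ℝ, E) (M := N)) z₀.2).symm z.2 (B z v)
      = ((trivializationAt (ℝ × E)
      (TangentSpace (𝓘(ℝ, ℝ).prod 𝓘(ℝ, E)) (M := ℝ × N)) z₀).symm z v).2 := by
    intro v
    rw [← Trivialization.symmL_apply (R := ℝ) _ hz2, ← Trivialization.symmL_apply (R := ℝ) _ hz]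
    change (trivializationAt E (TangentSpace 𝓘(ℝ, E) (M := N)) z₀.2).symmL ℝ z.2
      ((trivializationAt E (TangentSpace 𝓘(ℝ, E) (M := N)) z₀.2).continuousLinearMapAt ℝ z.2
      (mfderiv (𝓘(ℝ, ℝ).prod 𝓘(ℝ, E)) 𝓘(ℝ, E) (Prod.snd : ℝ × N → N) z
        ((trivializationAt (ℝ × E) (TangentSpace (𝓘(ℝ, ℝ).prod 𝓘(ℝ, E)) (M := ℝ × N)) z₀).symmL
          ℝ z v))) = _
    rw [Trivialization.symmL_continuousLinearMapAt _ hz2, mfderiv_snd]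
    rfl
  change _ = A z v * A z w + ρ z.1 ^ 2 * coordMetric g z₀.2 z.2 (B z v) (B z w)
  rw [coordMetric_apply g hz2, eA, eA, eB, eB, ← warpedInner_apply]
  exact congrArg (fun L : ℝ →ₗ[ℝ] ℝ => L (warpedInner ρ g z _ _))
    (Bundle.Trivial.linearMapAt_trivialization ℝ (ℝ × N) ℝ z)

/-- The metric `dt² + ρ(t)² g` of the warped product `ℝ ×_ρ N`. -/
def warpedMetric (ρ : ℝ → ℝ) (hρ : ContDiff ℝ ∞ ρ) (hpos : ∀ t, 0 < ρ t)
    (g : Metric 𝓘(ℝ, E) N) : Metric (𝓘(ℝ, ℝ).prod 𝓘(ℝ, E)) (ℝ × N) where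
  inner := warpedInner ρ g
  symm z v w := by
    rw [warpedInner_apply, warpedInner_apply, mul_comm]
    exact congrArg (fun r => w.1 * v.1 + ρ z.1 ^ 2 * r) (g.symm z.2 v.2 w.2)
  pos z v hv := warpedInner_pos hpos g z v hv
  isVonNBounded z := warpedInner_isVonNBounded hpos g z
  contMDiff := warpedInner_contMDiff hρ g

variable (N) in
/-- The vector field `∂_t` on `ℝ × N`. -/
def partialT (z : ℝ × N) : TangentSpace (𝓘(ℝ, ℝ).prod 𝓘(ℝ, E)) z := ((1 : ℝ), (0 : E))

/-- The graph `{(F x, x)}` of a function on `N`, parametrized by `N`. -/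
def graphMap (F : N → ℝ) (x : N) : ℝ × N := (F x, x)

end Warped

end CanonicalDirection

end

noncomputable section

namespace CanonicalDirection

/-! ### Christoffel symbols and metric compatibility along a map -/

section Riemannian

variable {E : Type*} [NormedAddCommGroup E] [NormedSpace ℝ E]
  {H : Type*} [TopologicalSpace H] {I : ModelWithCorners ℝ E H}
  {M : Type*} [TopologicalSpace M] [ChartedSpace H M] [IsManifold I ∞ M]
  {E' : Type*} [NormedAddCommGroup E'] [NormedSpace ℝ E']
  {H' : Type*} [TopologicalSpace H'] {I' : ModelWithCorners ℝ E' H'}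
  {S : Type*} [TopologicalSpace S] [ChartedSpace H' S]

/-! Write ξ = (θ, η), so that θ = ⟨ξ, ∂_t⟩. Unit length and orthogonality to the graph force
θ²(ρ(F)² + |∇F|²) = ρ(F)² (`IsUnitNormal.sq_fst`), so for transnormal F the function θ² depends on F
alone. Since θ² is C^1 because ξ is, a Lagrange multiplier argument at a point with dF ≠ 0 makes its
differential vanish on ker dF, whatever b looks like (`mvfderiv_eq_zero_of_eq_comp`). As θ never
vanishes, dθ vanishes on ker dF too.

Let T = ∂_t - θξ be non-zero at p; this forces dF ≠ 0 there. The tangent vectors of the graph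
orthogonal to T are the (0, v) with dF(v) = 0. For these, the warped metric gives ∇_v ∂_t =
(ρ'/ρ)(0, v), which is orthogonal to ξ. Differentiating θ = ⟨ξ, ∂_t⟩ yields ⟨∇_v ξ, ∂_t⟩ = dθ(v) =
0, and with ⟨∇_v ξ, ξ⟩ = 0 also ⟨∇_v ξ, T⟩ = 0. By symmetry of the shape operator
(`IsUnitNormal.inner_covDerivAlong_symm`), ∇_T ξ is orthogonal to every such (0, v), and to ξ. Hence
it is a multiple of T.

The connection enters only through metric compatibility and the symmetry of the Christoffel symbols,
both read off in the chart at the point under consideration. -/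

theorem trivializationAt_self_apply (x : M) (v : TangentSpace I x) :
    ((trivializationAt E (TangentSpace I (M := M)) x) (⟨x, v⟩ : TangentBundle I M)).2 = v :=
  (tangentBundleCore I M).coordChange_self (achart H x) x (mem_chart_source H x) v

theorem trivializationAt_self_symm (x : M) (v : E) :
    (trivializationAt E (TangentSpace I (M := M)) x).symm x v = v := by
  have h := (trivializationAt E (TangentSpace I (M := M)) x).symm_apply_apply_mk
    (FiberBundle.mem_baseSet_trivializationAt' x) (v : TangentSpace I x)
  rwa [trivializationAt_self_apply x (show TangentSpace I x from v)] at h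

theorem coordMetric_self (g : Metric I M) (x : M) (v w : TangentSpace I x) :
    coordMetric g x x v w = g.inner x v w := by
  have h := coordMetric_apply g (FiberBundle.mem_baseSet_trivializationAt' (F := E) x) v w
  exact h.trans (congrArg₂ (fun a b : TangentSpace I x => g.inner x a b)
    (trivializationAt_self_symm (E := E) x v) (trivializationAt_self_symm (E := E) x w))

theorem inner_eq_coordMetric (g : Metric I M) {x₀ x : M}
    (hx : x ∈ (trivializationAt E (TangentSpace I (M := M)) x₀).baseSet) (v w : TangentSpace I x) :
    g.inner x v w = coordMetric g x₀ x
      ((trivializationAt E (TangentSpace I (M := M)) x₀) (⟨x, v⟩ : TangentBundle I M)).2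
      ((trivializationAt E (TangentSpace I (M := M)) x₀) (⟨x, w⟩ : TangentBundle I M)).2 := by
  rw [coordMetric_apply g hx, Trivialization.symm_apply_apply_mk _ hx,
    Trivialization.symm_apply_apply_mk _ hx]

theorem coordMetric_symm (g : Metric I M) {x₀ x : M}
    (hx : x ∈ (trivializationAt E (TangentSpace I (M := M)) x₀).baseSet) (v w : E) :
    coordMetric g x₀ x v w = coordMetric g x₀ x w v := by
  rw [coordMetric_apply g hx, coordMetric_apply g hx, g.symm]

theorem contMDiffAt_coordMetric (g : Metric I M) (x : M) :
    ContMDiffAt I 𝓘(ℝ, E →L[ℝ] E →L[ℝ] ℝ) ∞ (coordMetric g x) x := by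
  have h := g.contMDiff x
  rw [contMDiffAt_hom_bundle] at h
  exact h.2

theorem mdifferentiableAt_coordMetric (g : Metric I M) (x : M) :
    MDifferentiableAt I 𝓘(ℝ, E →L[ℝ] E →L[ℝ] ℝ) (coordMetric g x) x :=
  (contMDiffAt_coordMetric g x).mdifferentiableAt (by simp)

theorem eventually_mem_baseSet (x : M) : ∀ᶠ y in nhds x,
    y ∈ (trivializationAt E (TangentSpace I (M := M)) x).baseSet :=
  (trivializationAt E (TangentSpace I (M := M)) x).open_baseSet.mem_nhds
    (FiberBundle.mem_baseSet_trivializationAt' x)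

/-- Product rule for evaluation; as all values lie in normed spaces, it is the vector-space rule
read in the source chart. -/
theorem _root_.HasMFDerivAt.clm_apply_vec {F₁ F₂ : Type*} [NormedAddCommGroup F₁]
    [NormedSpace ℝ F₁] [NormedAddCommGroup F₂] [NormedSpace ℝ F₂] {c : S → F₁ →L[ℝ] F₂}
    {u : S → F₁} {p : S} {c' : E' →L[ℝ] F₁ →L[ℝ] F₂} {u' : E' →L[ℝ] F₁}
    (hc : HasMFDerivAt I' 𝓘(ℝ, F₁ →L[ℝ] F₂) c p c') (hu : HasMFDerivAt I' 𝓘(ℝ, F₁) u p u') :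
    HasMFDerivAt I' 𝓘(ℝ, F₂) (fun q => c q (u q)) p ((c p).comp u' + c'.flip (u p)) := by
  refine ⟨hc.1.clm_apply hu.1, ?_⟩
  have h := HasFDerivWithinAt.clm_apply hc.2 hu.2
  simpa [writtenInExtChartAt, Function.comp_def] using! h

/-- The derivative of the components of the metric is the derivative of the individual
components. -/
theorem hasMFDerivAt_coordMetric_apply (g : Metric I M) (x : M) (v w : E) :
    HasMFDerivAt I 𝓘(ℝ, ℝ) (fun y => coordMetric g x y v w) x
      (((coordMetricDeriv g x).flip v).flip w) := by
  have h : HasMFDerivAt I 𝓘(ℝ, E →L[ℝ] E →L[ℝ] ℝ) (coordMetric g x) x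
      (coordMetricDeriv g x : E →L[ℝ] E →L[ℝ] E →L[ℝ] ℝ) :=
    (mdifferentiableAt_coordMetric g x).hasMFDerivAt
  have h1 := HasMFDerivAt.clm_apply_vec (HasMFDerivAt.clm_apply_vec
    (c' := coordMetricDeriv g x) (u' := 0) h (hasMFDerivAt_const v x)) (u' := 0)
    (hasMFDerivAt_const w x)
  refine h1.congr_mfderiv ?_
  ext z
  simp

/-- The components are symmetric on a whole neighbourhood of x, and derivatives depend only on
germs. -/
theorem coordMetricDeriv_symm (g : Metric I M) (x : M) (z v w : E) :
    coordMetricDeriv g x z v w = coordMetricDeriv g x z w v := by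
  have h1 := hasMFDerivAt_coordMetric_apply g x v w
  have h2 := hasMFDerivAt_coordMetric_apply g x w v
  have h3 := h1.congr_of_eventuallyEq (f₁ := fun y => coordMetric g x y w v) (by
    filter_upwards [eventually_mem_baseSet (I := I) x] with y hy
    exact coordMetric_symm g hy w v)
  have := hasMFDerivAt_unique h2 h3
  exact (congrArg (fun L : E →L[ℝ] ℝ => L z) this).symm

/-- Torsion-freeness of the connection. -/
theorem christoffelFirst_symm (g : Metric I M) (x : M) (v w z : E) :
    christoffelFirst g x v w z = christoffelFirst g x w v z := by
  rw [christoffelFirst_apply, christoffelFirst_apply, coordMetricDeriv_symm g x z v w]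
  ring

/-- Metric compatibility in coordinates: in the sum, the terms differentiated along v and w cancel.
-/
theorem christoffelFirst_add_christoffelFirst (g : Metric I M) (x : M) (z v w : E) :
    christoffelFirst g x z v w + christoffelFirst g x z w v = coordMetricDeriv g x z v w := by
  rw [christoffelFirst_apply, christoffelFirst_apply, coordMetricDeriv_symm g x z w v,
    coordMetricDeriv_symm g x w z v, coordMetricDeriv_symm g x v z w]
  ring

variable (I) in
/-- The components of a vector field along `f` in the chart at `f p`. -/
def coordField (f : S → M) (p : S) (V : ∀ p : S, TangentSpace I (f p)) (q : S) : E :=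
  ((trivializationAt E (TangentSpace I (M := M)) (f p)) (⟨f q, V q⟩ : TangentBundle I M)).2

theorem inner_christoffel [FiniteDimensional ℝ E] (g : Metric I M) (x : M)
    (v w z : TangentSpace I x) :
    g.inner x (christoffel g x v w) z = christoffelFirst g x v w z :=
  congrArg (fun φ : TangentSpace I x →L[ℝ] ℝ => φ z) ((flat g x).apply_symm_apply _)

/-- Lowering the index leaves only Christoffel symbols of the first kind, so later computations
never meet the inverse metric. -/
theorem inner_covDerivAlong [FiniteDimensional ℝ E] (g : Metric I M) (f : S → M)
    (V : ∀ p : S, TangentSpace I (f p)) (p : S) (v : TangentSpace I' p)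
    (w : TangentSpace I (f p)) :
    g.inner (f p) (covDerivAlong I' g f V p v) w =
      coordMetric g (f p) (f p) (mvfderiv I' (coordField I f p V) p v) w
        + christoffelFirst g (f p) (mfderiv I' I f p v) (V p) w := by
  have h1 : ∀ a b : TangentSpace I (f p),
      g.inner (f p) (a + b) w = g.inner (f p) a w + g.inner (f p) b w := fun a b => by
    rw [map_add, _root_.add_apply]
  refine (h1 _ _).trans (congrArg₂ (· + ·) ?_ (inner_christoffel g _ _ _ w))
  exact (congrArg (fun a : TangentSpace I (f p) => g.inner (f p) a w)
    (trivializationAt_self_symm (f p) _)).trans (coordMetric_self g (f p) _ _).symm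

theorem eventually_inner_eq (g : Metric I M) {f : S → M} {p : S} (hf : ContinuousAt f p)
    (V W : ∀ p : S, TangentSpace I (f p)) :
    (fun q => g.inner (f q) (V q) (W q)) =ᶠ[nhds p]
      fun q => coordMetric g (f p) (f q) (coordField I f p V q) (coordField I f p W q) := by
  filter_upwards [hf.eventually (eventually_mem_baseSet (I := I) (f p))] with q hq
  exact inner_eq_coordMetric g hq _ _

/-- The Levi-Civita derivative along a map is compatible with the metric. -/
theorem mvfderiv_inner_along [FiniteDimensional ℝ E] (g : Metric I M) {f : S → M} {p : S}
    (hf : MDifferentiableAt I' I f p) (V W : ∀ p : S, TangentSpace I (f p))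
    (hV : MDifferentiableAt I' 𝓘(ℝ, E) (coordField I f p V) p)
    (hW : MDifferentiableAt I' 𝓘(ℝ, E) (coordField I f p W) p)
    (v : TangentSpace I' p) : mvfderiv I' (fun q => g.inner (f q) (V q) (W q)) p v =
      g.inner (f p) (covDerivAlong I' g f V p v) (W p)
        + g.inner (f p) (V p) (covDerivAlong I' g f W p v) := by
  have hG : HasMFDerivAt I' 𝓘(ℝ, E →L[ℝ] E →L[ℝ] ℝ) (fun q => coordMetric g (f p) (f q)) p
      ((coordMetricDeriv g (f p)).comp (mfderiv I' I f p : E' →L[ℝ] E)) :=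
    (mdifferentiableAt_coordMetric g (f p)).hasMFDerivAt.comp p hf.hasMFDerivAt
  have h1 := (hG.clm_apply_vec hV.hasMFDerivAt).clm_apply_vec hW.hasMFDerivAt
  have h2 := h1.congr_of_eventuallyEq (eventually_inner_eq g hf.continuousAt V W)
  have h3 := congrArg (fun L : E' →L[ℝ] ℝ => L v) h2.mfderiv
  have eV : coordField I f p V p = V p := trivializationAt_self_apply _ _
  have eW : coordField I f p W p = W p := trivializationAt_self_apply _ _
  rw [g.symm (f p) (V p), inner_covDerivAlong, inner_covDerivAlong]
  refine h3.trans ?_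
  have h4 := christoffelFirst_add_christoffelFirst g (f p) (mfderiv I' I f p v) (V p) (W p)
  have h5 := coordMetric_symm g (FiberBundle.mem_baseSet_trivializationAt' (F := E) (f p))
    (V p) (mvfderiv I' (coordField I f p W) p v)
  change coordMetric g (f p) (f p) (coordField I f p V p) (mvfderiv I' (coordField I f p W) p v) +
    (coordMetric g (f p) (f p) (mvfderiv I' (coordField I f p V) p v) (coordField I f p W p) +
      coordMetricDeriv g (f p) (mfderiv I' I f p v) (coordField I f p V p)
        (coordField I f p W p)) = _
  rw [eV, eW]
  linarith

end Riemannian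

/-! ### Coordinates and Christoffel symbols of the warped product -/

section Warped

variable {E : Type*} [NormedAddCommGroup E] [NormedSpace ℝ E]
  {N : Type*} [TopologicalSpace N] [ChartedSpace E N] [IsManifold 𝓘(ℝ, E) ∞ N]

/-- Charts of the product are products of charts with the identity on ℝ, so the derivative of a
transition map is block diagonal. -/
theorem trivializationAt_prod_snd {z₀ z : ℝ × N} (hz : z.2 ∈ (chartAt E z₀.2).source)
    (v : TangentSpace (𝓘(ℝ, ℝ).prod 𝓘(ℝ, E)) z) :
    ((trivializationAt (ℝ × E) (TangentSpace (𝓘(ℝ, ℝ).prod 𝓘(ℝ, E)) (M := ℝ × N)) z₀)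
      (⟨z, v⟩ : TangentBundle (𝓘(ℝ, ℝ).prod 𝓘(ℝ, E)) (ℝ × N))).2 =
    (v.1, ((trivializationAt E (TangentSpace 𝓘(ℝ, E) (M := N)) z₀.2)
      (⟨z.2, v.2⟩ : TangentBundle 𝓘(ℝ, E) N)).2) := by
  have hD : DifferentiableAt ℝ ((chartAt E z₀.2).extend 𝓘(ℝ, E) ∘
      ((chartAt E z.2).extend 𝓘(ℝ, E)).symm) ((chartAt E z.2).extend 𝓘(ℝ, E) z.2) := by
    have h := contDiffWithinAt_ext_coord_change (I := 𝓘(ℝ, E)) (n := ∞) z₀.2 z.2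
      (y := (chartAt E z.2).extend 𝓘(ℝ, E) z.2) (by simp [hz])
    rw [modelWithCornersSelf_coe, Set.range_id, contDiffWithinAt_univ] at h
    exact h.differentiableAt (by simp)
  rw [TangentBundle.trivializationAt_apply, TangentBundle.trivializationAt_apply]
  have h1 : HasFDerivAt (Prod.map (id : ℝ → ℝ) ((chartAt E z₀.2).extend 𝓘(ℝ, E) ∘
      ((chartAt E z.2).extend 𝓘(ℝ, E)).symm)) _ (z.1, (chartAt E z.2).extend 𝓘(ℝ, E) z.2) :=
    HasFDerivAt.prodMap _ (hasFDerivAt_id z.1) hD.hasFDerivAt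
  have hr : Set.range (𝓘(ℝ, ℝ).prod 𝓘(ℝ, E)) = Set.univ := by
    simp
  have hr' : Set.range 𝓘(ℝ, E) = Set.univ := by simp
  rw [hr, hr', fderivWithin_univ, fderivWithin_univ]
  have h2 := congrArg (fun L : ℝ × E →L[ℝ] ℝ × E => L v) h1.fderiv
  exact h2

theorem trivializationAt_prod_symm {z₀ z : ℝ × N} (hz : z.2 ∈ (chartAt E z₀.2).source)
    (v : ℝ × E) :
    (trivializationAt (ℝ × E) (TangentSpace (𝓘(ℝ, ℝ).prod 𝓘(ℝ, E)) (M := ℝ × N)) z₀).symm z v =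
    ((v.1, (trivializationAt E (TangentSpace 𝓘(ℝ, E) (M := N)) z₀.2).symm z.2 v.2) : ℝ × E) := by
  have hz' : z ∈ (trivializationAt (ℝ × E)
      (TangentSpace (𝓘(ℝ, ℝ).prod 𝓘(ℝ, E)) (M := ℝ × N)) z₀).baseSet :=
    ⟨trivial, hz⟩
  have h := (trivializationAt (ℝ × E)
      (TangentSpace (𝓘(ℝ, ℝ).prod 𝓘(ℝ, E)) (M := ℝ × N)) z₀).apply_mk_symm hz' v
  have h2 := (trivializationAt_prod_snd hz _).symm.trans (congrArg Prod.snd h)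
  have h3 := (trivializationAt E (TangentSpace 𝓘(ℝ, E) (M := N)) z₀.2).symm_apply_apply_mk
    (b := z.2) hz ((trivializationAt (ℝ × E)
      (TangentSpace (𝓘(ℝ, ℝ).prod 𝓘(ℝ, E)) (M := ℝ × N)) z₀).symm z v).2
  rw [Prod.ext_iff] at h2
  refine Prod.ext h2.1 ?_
  rw [← h2.2]
  exact h3.symm

theorem coordMetric_warpedMetric (ρ : ℝ → ℝ) (hρ : ContDiff ℝ ∞ ρ) (hpos : ∀ t, 0 < ρ t)
    (g : Metric 𝓘(ℝ, E) N) {z₀ z : ℝ × N} (hz : z.2 ∈ (chartAt E z₀.2).source) (v w : ℝ × E) :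
    coordMetric (warpedMetric ρ hρ hpos g) z₀ z v w =
      v.1 * w.1 + ρ z.1 ^ 2 * coordMetric g z₀.2 z.2 v.2 w.2 := by
  have hz' : z ∈ (trivializationAt (ℝ × E)
      (TangentSpace (𝓘(ℝ, ℝ).prod 𝓘(ℝ, E)) (M := ℝ × N)) z₀).baseSet :=
    ⟨trivial, hz⟩
  rw [coordMetric_apply _ hz', trivializationAt_prod_symm hz, trivializationAt_prod_symm hz,
    coordMetric_apply g hz]
  exact warpedInner_apply ρ g z _ _

theorem coordMetricDeriv_warpedMetric (ρ : ℝ → ℝ) (hρ : ContDiff ℝ ∞ ρ) (hpos : ∀ t, 0 < ρ t)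
    (g : Metric 𝓘(ℝ, E) N) (z : ℝ × N) (u v w : ℝ × E) :
    coordMetricDeriv (warpedMetric ρ hρ hpos g) z u v w =
      2 * ρ z.1 * deriv ρ z.1 * u.1 * coordMetric g z.2 z.2 v.2 w.2
        + ρ z.1 ^ 2 * coordMetricDeriv g z.2 u.2 v.2 w.2 := by
  have h1 := hasMFDerivAt_coordMetric_apply (warpedMetric ρ hρ hpos g) z v w
  have hev : ∀ᶠ y : ℝ × N in nhds z, y.2 ∈ (chartAt E z.2).source :=
    continuous_snd.continuousAt.preimage_mem_nhds (chart_source_mem_nhds E z.2)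
  have hK : HasMFDerivAt (𝓘(ℝ, ℝ).prod 𝓘(ℝ, E)) 𝓘(ℝ, ℝ)
      (fun y : ℝ × N => coordMetric g z.2 y.2 v.2 w.2) z
      ((((coordMetricDeriv g z.2).flip v.2).flip w.2).comp (ContinuousLinearMap.snd ℝ ℝ E) :
        ℝ × E →L[ℝ] ℝ) :=
    (hasMFDerivAt_coordMetric_apply g z.2 v.2 w.2).comp z (hasMFDerivAt_snd (I := 𝓘(ℝ, ℝ)) (I' := 𝓘(ℝ, E)) z)
  have hd : HasDerivAt (fun t => ρ t ^ 2) (2 * ρ z.1 * deriv ρ z.1) z.1 := by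
    have := ((hρ.differentiable (by simp)) z.1).hasDerivAt.pow 2
    simpa using! this
  have hR : HasMFDerivAt (𝓘(ℝ, ℝ).prod 𝓘(ℝ, E)) 𝓘(ℝ, ℝ) (fun y : ℝ × N => ρ y.1 ^ 2) z
      ((2 * ρ z.1 * deriv ρ z.1) • ContinuousLinearMap.fst ℝ ℝ E : ℝ × E →L[ℝ] ℝ) := by
    refine HasMFDerivAt.congr_mfderiv ((hd.hasFDerivAt.hasMFDerivAt).comp z (hasMFDerivAt_fst (I := 𝓘(ℝ, ℝ))
    (I' := 𝓘(ℝ, E)) z)) ?_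
    refine ContinuousLinearMap.ext fun u => ?_
    change u.1 * (2 * ρ z.1 * deriv ρ z.1) = (2 * ρ z.1 * deriv ρ z.1) * u.1
    ring
  have h2 := (hasMFDerivAt_const (I := 𝓘(ℝ, ℝ).prod 𝓘(ℝ, E)) (I' := 𝓘(ℝ, ℝ)) (v.1 * w.1) z).add
    (hR.mul hK)
  have h3 := h2.congr_of_eventuallyEq
    (f₁ := fun y => coordMetric (warpedMetric ρ hρ hpos g) z y v w) (by
      filter_upwards [hev] with y hy
      exact coordMetric_warpedMetric ρ hρ hpos g hy v w)
  have h4 := congrArg (fun L : ℝ × E →L[ℝ] ℝ => L u) (hasMFDerivAt_unique h1 h3)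
  refine h4.trans ?_
  change (0 : ℝ) + (ρ z.1 ^ 2 * coordMetricDeriv g z.2 u.2 v.2 w.2 +
    coordMetric g z.2 z.2 v.2 w.2 * ((2 * ρ z.1 * deriv ρ z.1) * u.1)) = _
  ring

/-- This is ∇_v ∂_t = (ρ'/ρ) v^N, with v^N the N-component of v, paired with w: the constant field
∂_t only sees the t-derivative of ρ². No other Christoffel symbol of the warped product has to be
computed. -/
theorem christoffelFirst_warpedMetric_partialT (ρ : ℝ → ℝ) (hρ : ContDiff ℝ ∞ ρ)
    (hpos : ∀ t, 0 < ρ t) (g : Metric 𝓘(ℝ, E) N) (z : ℝ × N) (v w : ℝ × E) :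
    christoffelFirst (warpedMetric ρ hρ hpos g) z v (1, 0) w =
      ρ z.1 * deriv ρ z.1 * coordMetric g z.2 z.2 v.2 w.2 := by
  rw [christoffelFirst_apply, coordMetricDeriv_warpedMetric, coordMetricDeriv_warpedMetric,
    coordMetricDeriv_warpedMetric]
  have e1 : coordMetric g z.2 z.2 0 w.2 = 0 := by rw [ContinuousLinearMap.map_zero]; rfl
  have e2 : coordMetricDeriv g z.2 v.2 0 w.2 = 0 := by rw [ContinuousLinearMap.map_zero]; rfl
  have e3 : coordMetric g z.2 z.2 v.2 0 = 0 := map_zero _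
  have e4 : coordMetricDeriv g z.2 w.2 v.2 0 = 0 := map_zero _
  have e5 : coordMetricDeriv g z.2 0 v.2 w.2 = 0 := by rw [ContinuousLinearMap.map_zero]; rfl
  rw [e1, e2, e3, e4, e5]
  ring

end Warped

/-! ### Differentials read in a chart, and functions of F -/

section ChartDerivative

variable {E : Type*} [NormedAddCommGroup E] [NormedSpace ℝ E]
  {N : Type*} [TopologicalSpace N] [ChartedSpace E N]
  {F₁ : Type*} [NormedAddCommGroup F₁] [NormedSpace ℝ F₁]

/-- A map read in the chart at `p`. -/
def readInChart (F : N → F₁) (p : N) (y : E) : F₁ := F ((chartAt E p).symm y)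

theorem _root_.ContMDiffAt.contDiffAt_readInChart {F : N → F₁} {p : N} {n : ℕ∞ω}
    (hF : ContMDiffAt 𝓘(ℝ, E) 𝓘(ℝ, F₁) n F p) :
    ContDiffAt ℝ n (readInChart F p) (chartAt E p p) := by
  have h := (contMDiffAt_iff.1 hF).2
  simpa [readInChart, Function.comp_def, contDiffWithinAt_univ] using! h

theorem mvfderiv_eq_fderiv_readInChart {F : N → F₁} {p : N}
    (hF : MDifferentiableAt 𝓘(ℝ, E) 𝓘(ℝ, F₁) F p) (v : E) :
    mvfderiv 𝓘(ℝ, E) F p v = fderiv ℝ (readInChart F p) (chartAt E p p) v := by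
  have h := hF.mvfderiv
  rw [show Set.range 𝓘(ℝ, E) = Set.univ by simp, fderivWithin_univ] at h
  exact congrArg (fun L : E →L[ℝ] F₁ => L v) h

/-- A `C^1` function which is a function of `F` has a differential vanishing on the kernel of `dF`
at regular points of `F`. -/
theorem mvfderiv_eq_zero_of_eq_comp [CompleteSpace E] {F ψ : N → ℝ} {p : N}
    (hF : ContMDiffAt 𝓘(ℝ, E) 𝓘(ℝ, ℝ) 1 F p) (hψ : ContMDiffAt 𝓘(ℝ, E) 𝓘(ℝ, ℝ) 1 ψ p)
    (h : ∀ q, F q = F p → ψ q = ψ p) (hd : mvfderiv 𝓘(ℝ, E) F p ≠ 0) (v : TangentSpace 𝓘(ℝ, E) p)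
    (hv : mvfderiv 𝓘(ℝ, E) F p v = 0) : mvfderiv 𝓘(ℝ, E) ψ p v = 0 := by
  have eF := mvfderiv_eq_fderiv_readInChart (hF.mdifferentiableAt (by simp))
  have eψ := mvfderiv_eq_fderiv_readInChart (hψ.mdifferentiableAt (by simp))
  have sF := hF.contDiffAt_readInChart.hasStrictFDerivAt (by simp)
  have sψ := hψ.contDiffAt_readInChart.hasStrictFDerivAt (by simp)
  have hp : (chartAt E p).symm (chartAt E p p) = p := (chartAt E p).left_inv (mem_chart_source E p)
  -- Being constant on the level set, ψ has a trivial constrained extremum at p, so a multiplier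
  -- relation between dF and dψ follows without differentiating the function that links ψ to F.
  have hext : IsLocalExtrOn (readInChart ψ p)
      {y | readInChart F p y = readInChart F p (chartAt E p p)} (chartAt E p p) := by
    left
    refine eventually_nhdsWithin_of_forall fun y hy => ?_
    have : readInChart ψ p (chartAt E p p) = readInChart ψ p y := by
      simp only [readInChart, Set.mem_ofPred_eq, hp] at hy ⊢
      exact (h _ hy).symm
    exact this.le
  obtain ⟨a, b, hab, hlin⟩ := hext.exists_multipliers_of_hasStrictFDerivAt_1d sF sψ
  have hlin' : ∀ w : E, a * mvfderiv 𝓘(ℝ, E) F p w + b * mvfderiv 𝓘(ℝ, E) ψ p w = 0 := fun w => by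
    rw [eF, eψ]
    exact congrArg (fun L : E →L[ℝ] ℝ => L w) hlin
  have hb : b ≠ 0 := by
    rintro rfl
    have ha : a ≠ 0 := by
      rintro rfl
      exact hab rfl
    refine hd (ContinuousLinearMap.ext fun w => ?_)
    have := hlin' w
    simpa [ha] using! this
  have h1 := hlin' v
  rw [show mvfderiv 𝓘(ℝ, E) F p (v : E) = 0 from hv] at h1
  simpa [hb] using! h1

/-- The differential of `F` at `q` in the chart at `p`. -/
def chartDifferential (F : N → ℝ) (p q : N) : E →L[ℝ] ℝ :=
  fderiv ℝ (readInChart F p) (chartAt E p q)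

theorem contMDiffAt_chartDifferential {F : N → ℝ} (hF : ContMDiff 𝓘(ℝ, E) 𝓘(ℝ, ℝ) 2 F) (p : N) :
    ContMDiffAt 𝓘(ℝ, E) 𝓘(ℝ, E →L[ℝ] ℝ) 1 (chartDifferential (E := E) F p) p := by
  have h1 : ContDiffAt ℝ 1 (fderiv ℝ (readInChart F p)) (chartAt E p p) :=
    hF.contMDiffAt.contDiffAt_readInChart.fderiv_right (by norm_num)
  exact h1.contMDiffAt.comp p (contMDiffAt_extChartAt (I := 𝓘(ℝ, E)) (n := 1) (x := p))

variable [IsManifold 𝓘(ℝ, E) ∞ N]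

theorem hasMFDerivAt_chartAt_self (p : N) :
    HasMFDerivAt 𝓘(ℝ, E) 𝓘(ℝ, E) (chartAt E p) p (ContinuousLinearMap.id ℝ E) := by
  have : IsManifold 𝓘(ℝ, E) 1 N := IsManifold.of_le (n := ∞) (by simp)
  have h := (mdifferentiableAt_extChartAt (I := 𝓘(ℝ, E)) (mem_chart_source E p)).hasMFDerivAt
  rw [mfderiv_extChartAt_self] at h
  exact h

/-- Chain rule for F as its chart expression after the chart, whose differential at q is the
trivialization. -/
theorem mvfderiv_eq_chartDifferential {F : N → ℝ} (hF : ContMDiff 𝓘(ℝ, E) 𝓘(ℝ, ℝ) 2 F) {p q : N}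
    (hq : q ∈ (chartAt E p).source) (w : TangentSpace 𝓘(ℝ, E) q) :
    mvfderiv 𝓘(ℝ, E) F q w = chartDifferential F p q
      ((trivializationAt E (TangentSpace 𝓘(ℝ, E) (M := N)) p)
        (⟨q, w⟩ : TangentBundle 𝓘(ℝ, E) N)).2 := by
  have : IsManifold 𝓘(ℝ, E) 1 N := IsManifold.of_le (n := ∞) (by simp)
  have hφ := (mdifferentiableAt_extChartAt (I := 𝓘(ℝ, E)) hq).hasMFDerivAt
  rw [← TangentBundle.continuousLinearMapAt_trivializationAt hq] at hφ
  have hF2 : DifferentiableAt ℝ (readInChart F p) (chartAt E p q) := by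
    have h1 : ContMDiffAt 𝓘(ℝ, E) 𝓘(ℝ, ℝ) 2 (F ∘ (extChartAt 𝓘(ℝ, E) p).symm)
        (chartAt E p q) :=
      hF.contMDiffAt.comp _ ((contMDiffOn_extChartAt_symm (n := 2) p).contMDiffAt
        (extChartAt_target_mem_nhds' (by simp [hq])))
    exact h1.contDiffAt.differentiableAt (by simp)
  have h1 : HasMFDerivAt 𝓘(ℝ, E) 𝓘(ℝ, ℝ) (readInChart F p ∘ extChartAt 𝓘(ℝ, E) p) q _ :=
    hF2.hasFDerivAt.hasMFDerivAt.comp q hφ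
  have h2 := h1.congr_of_eventuallyEq (f₁ := F) (by
    filter_upwards [(chartAt E p).open_source.mem_nhds hq] with y hy
    simp [readInChart, (chartAt E p).left_inv hy])
  have h3 := congrArg (fun L : E →L[ℝ] ℝ => L w) h2.mfderiv
  refine h3.trans (congrArg (fun z : E => chartDifferential F p q z) ?_)
  exact (trivializationAt E (TangentSpace 𝓘(ℝ, E) (M := N)) p).continuousLinearMapAt_apply_of_mem
    ℝ hq w

/-- Equality of mixed partials of a C^2 function: the chart at p has identity differential at p, so
both sides are values of the second derivative of `readInChart F p`. -/
theorem mvfderiv_chartDifferential_symm {F : N → ℝ} (hF : ContMDiff 𝓘(ℝ, E) 𝓘(ℝ, ℝ) 2 F) (p : N)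
    (u v : E) : mvfderiv 𝓘(ℝ, E) (fun q => chartDifferential (E := E) F p q v) p u =
      mvfderiv 𝓘(ℝ, E) (fun q => chartDifferential (E := E) F p q u) p v := by
  have h0 := hF.contMDiffAt (x := p) |>.contDiffAt_readInChart
  have h1 : ContDiffAt ℝ 1 (fderiv ℝ (readInChart F p)) (chartAt E p p) :=
    h0.fderiv_right (by norm_num)
  have key : ∀ u v : E, mvfderiv 𝓘(ℝ, E) (fun q => chartDifferential (E := E) F p q v) p u =
      fderiv ℝ (fderiv ℝ (readInChart F p)) (chartAt E p p) u v := fun u v => by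
    have h2 := (((ContinuousLinearMap.apply ℝ ℝ v).hasFDerivAt.comp _
      (h1.differentiableAt (by simp)).hasFDerivAt).hasMFDerivAt).comp p
      (hasMFDerivAt_chartAt_self p)
    exact congrArg (fun L : E →L[ℝ] ℝ => L u) h2.mfderiv
  rw [key, key]
  exact h0.isSymmSndFDerivAt (by simp) u v

end ChartDerivative

/-! ### The graph as a hypersurface and its explicit unit normal -/

section Graph

variable {E : Type*} [NormedAddCommGroup E] [NormedSpace ℝ E]
  {N : Type*} [TopologicalSpace N] [ChartedSpace E N]

theorem hasMFDerivAt_graphMap {F : N → ℝ} {p : N}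
    (hF : MDifferentiableAt 𝓘(ℝ, E) 𝓘(ℝ, ℝ) F p) :
    HasMFDerivAt 𝓘(ℝ, E) (𝓘(ℝ, ℝ).prod 𝓘(ℝ, E)) (graphMap F) p
      ((mvfderiv 𝓘(ℝ, E) F p : E →L[ℝ] ℝ).prod (ContinuousLinearMap.id ℝ E)) :=
  hF.hasMFDerivAt.prodMk (hasMFDerivAt_id p)

theorem mfderiv_graphMap {F : N → ℝ} {p : N}
    (hF : MDifferentiableAt 𝓘(ℝ, E) 𝓘(ℝ, ℝ) F p) (v : TangentSpace 𝓘(ℝ, E) p) :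
    mfderiv 𝓘(ℝ, E) (𝓘(ℝ, ℝ).prod 𝓘(ℝ, E)) (graphMap F) p v =
      ((mvfderiv 𝓘(ℝ, E) F p v, v) : ℝ × E) :=
  congrArg (fun L : E →L[ℝ] ℝ × E => L v) (hasMFDerivAt_graphMap hF).mfderiv

theorem contMDiff_graphMap {F : N → ℝ} (hF : ContMDiff 𝓘(ℝ, E) 𝓘(ℝ, ℝ) 2 F) :
    ContMDiff 𝓘(ℝ, E) (𝓘(ℝ, ℝ).prod 𝓘(ℝ, E)) 2 (graphMap F) :=
  hF.prodMk contMDiff_id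

theorem isHypersurface_graphMap [FiniteDimensional ℝ E] {F : N → ℝ}
    (hF : ContMDiff 𝓘(ℝ, E) 𝓘(ℝ, ℝ) 2 F) :
    IsHypersurface (𝓘(ℝ, ℝ).prod 𝓘(ℝ, E)) 𝓘(ℝ, E) (graphMap F) where
  contMDiff := contMDiff_graphMap hF
  isEmbedding := Topology.IsEmbedding.of_leftInverse (f := Prod.snd) (fun _ => rfl)
    continuous_snd (contMDiff_graphMap hF).continuous
  injective_mfderiv p v w hvw := by
    rw [mfderiv_graphMap (hF.mdifferentiable (by simp) p),
      mfderiv_graphMap (hF.mdifferentiable (by simp) p)] at hvw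
    exact congrArg Prod.snd hvw
  codim_one := by rw [Module.finrank_prod, Module.finrank_self, add_comm]

variable [IsManifold 𝓘(ℝ, E) ∞ N]

/-- In coordinates the gradient is G⁻¹ dF, where inversion of operators is smooth at G and dF is
C^1. -/
theorem contMDiffAt_coord_gradient [FiniteDimensional ℝ E] (g : Metric 𝓘(ℝ, E) N) {F : N → ℝ}
    (hF : ContMDiff 𝓘(ℝ, E) 𝓘(ℝ, ℝ) 2 F) (p : N) :
    ContMDiffAt 𝓘(ℝ, E) 𝓘(ℝ, E) 1 (fun q => ((trivializationAt E
      (TangentSpace 𝓘(ℝ, E) (M := N)) p)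
        (⟨q, gradient g F q⟩ : TangentBundle 𝓘(ℝ, E) N)).2) p := by
  let e : E ≃L[ℝ] (E →L[ℝ] ℝ) :=
    LinearEquiv.toContinuousLinearEquiv (𝕜 := ℝ) (E := E) (F := E →L[ℝ] ℝ) (flat g p)
  have he : coordMetric g p p = e := by
    ext v w
    exact coordMetric_self g p v w
  have hG := (contMDiffAt_coordMetric g p).of_le (m := 1) (by simp)
  -- Invertible operators form an open set, so near p `ContinuousLinearMap.inverse` is a genuine
  -- inverse and not its default value.
  have hinv : ∀ᶠ q in nhds p, coordMetric g p q ∈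
      Set.range ((↑) : (E ≃L[ℝ] (E →L[ℝ] ℝ)) → E →L[ℝ] E →L[ℝ] ℝ) := by
    apply hG.continuousAt.eventually
    rw [he]
    exact ContinuousLinearEquiv.nhds e
  have h1 : ContMDiffAt 𝓘(ℝ, E) 𝓘(ℝ, (E →L[ℝ] ℝ) →L[ℝ] E) 1
      (fun q => ContinuousLinearMap.inverse (coordMetric g p q)) p := by
    have h2 : ContDiffAt ℝ 1 (ContinuousLinearMap.inverse : (E →L[ℝ] E →L[ℝ] ℝ) → _)
        (coordMetric g p p) := by
      rw [he]
      exact contDiffAt_map_inverse e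
    exact h2.contMDiffAt.comp p hG
  refine (h1.clm_apply (contMDiffAt_chartDifferential hF p)).congr_of_eventuallyEq ?_
  filter_upwards [hinv, eventually_mem_baseSet (I := 𝓘(ℝ, E)) p] with q ⟨e', he'⟩ hq
  have h3 : coordMetric g p q ((trivializationAt E (TangentSpace 𝓘(ℝ, E) (M := N)) p)
        (⟨q, gradient g F q⟩ : TangentBundle 𝓘(ℝ, E) N)).2 = chartDifferential F p q := by
    ext w
    have h4 := inner_eq_coordMetric g hq (gradient g F q)
      ((trivializationAt E (TangentSpace 𝓘(ℝ, E) (M := N)) p).symm q w)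
    rw [inner_gradient, mvfderiv_eq_chartDifferential hF hq, Trivialization.apply_mk_symm _ hq]
      at h4
    exact h4.symm
  rw [← h3, ← he', ContinuousLinearMap.inverse_equiv]
  exact (e'.symm_apply_apply _).symm

/-- |∇F|² equals dF(∇F), a pairing of two C^1 objects. -/
theorem contMDiff_inner_gradient [FiniteDimensional ℝ E] (g : Metric 𝓘(ℝ, E) N) {F : N → ℝ}
    (hF : ContMDiff 𝓘(ℝ, E) 𝓘(ℝ, ℝ) 2 F) :
    ContMDiff 𝓘(ℝ, E) 𝓘(ℝ, ℝ) 1 (fun q => g.inner q (gradient g F q) (gradient g F q)) := by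
  intro p
  refine ((contMDiffAt_chartDifferential hF p).clm_apply
    (contMDiffAt_coord_gradient g hF p)).congr_of_eventuallyEq ?_
  filter_upwards [eventually_mem_baseSet (I := 𝓘(ℝ, E)) p] with q hq
  rw [inner_gradient, mvfderiv_eq_chartDifferential hF hq]

/-- The upward unit normal of a graph. -/
def graphNormal [FiniteDimensional ℝ E] (ρ : ℝ → ℝ) (g : Metric 𝓘(ℝ, E) N) (F : N → ℝ) (x : N) :
    TangentSpace (𝓘(ℝ, ℝ).prod 𝓘(ℝ, E)) (graphMap F x) :=
  let θ := (Real.sqrt (ρ (F x) ^ 2 + g.inner x (gradient g F x) (gradient g F x)))⁻¹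
  ((ρ (F x) * θ, -(θ / ρ (F x)) • gradient g F x) : ℝ × E)

theorem inner_self_nonneg (g : Metric 𝓘(ℝ, E) N) (x : N) (v : TangentSpace 𝓘(ℝ, E) x) :
    0 ≤ g.inner x v v := by
  by_cases h : v = 0
  · rw [h, map_zero]
  · exact (g.pos x v h).le

theorem contMDiff_graphNormal [FiniteDimensional ℝ E] {ρ : ℝ → ℝ} (hρ : ContDiff ℝ ∞ ρ)
    (hpos : ∀ t, 0 < ρ t) (g : Metric 𝓘(ℝ, E) N) {F : N → ℝ}
    (hF : ContMDiff 𝓘(ℝ, E) 𝓘(ℝ, ℝ) 2 F) :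
    ContMDiff 𝓘(ℝ, E) (𝓘(ℝ, ℝ).prod 𝓘(ℝ, E)).tangent 1 (fun p => (⟨graphMap F p,
      graphNormal ρ g F p⟩ : TangentBundle (𝓘(ℝ, ℝ).prod 𝓘(ℝ, E)) (ℝ × N))) := by
  have : IsManifold 𝓘(ℝ, E) 1 N := IsManifold.of_le (n := ∞) (by simp)
  intro p
  have hr : ContMDiffAt 𝓘(ℝ, E) 𝓘(ℝ, ℝ) 1 (fun q => ρ (F q)) p :=
    ((hρ.of_le (by simp)).contMDiff.contMDiffAt).comp p (hF.of_le (by norm_num)).contMDiffAt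
  -- Positivity of ρ keeps the radicand away from zero even at critical points of F, so the square
  -- root costs no regularity.
  have hs : ∀ q, 0 < ρ (F q) ^ 2 + g.inner q (gradient g F q) (gradient g F q) := fun q => by
    have := hpos (F q)
    have := inner_self_nonneg g q (gradient g F q)
    positivity
  have hθ : ContMDiffAt 𝓘(ℝ, E) 𝓘(ℝ, ℝ) 1
      (fun q => (Real.sqrt (ρ (F q) ^ 2 + g.inner q (gradient g F q) (gradient g F q)))⁻¹) p := by
    have h1 : ContMDiffAt 𝓘(ℝ, E) 𝓘(ℝ, ℝ) 1
      (fun q => ρ (F q) ^ 2 + g.inner q (gradient g F q) (gradient g F q)) p :=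
      (hr.pow 2).add (contMDiff_inner_gradient g hF p)
    have h2 : ContDiffAt ℝ 1 (fun s => (Real.sqrt s)⁻¹)
        (ρ (F p) ^ 2 + g.inner p (gradient g F p) (gradient g F p)) :=
      (Real.contDiffAt_sqrt (hs p).ne').inv (Real.sqrt_pos.2 (hs p)).ne'
    exact ContMDiffAt.comp (g := fun s => (Real.sqrt s)⁻¹) p h2.contMDiffAt h1
  have hr' : ContMDiffAt 𝓘(ℝ, E) 𝓘(ℝ, ℝ) 1 (fun q => (ρ (F q))⁻¹) p :=
    (contDiffAt_inv ℝ (hpos (F p)).ne').contMDiffAt.comp p hr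
  have hR : ContMDiffAt 𝓘(ℝ, E) (𝓘(ℝ, ℝ).prod 𝓘(ℝ, E)) 1 (graphMap F) p :=
    (contMDiff_graphMap hF).contMDiffAt.of_le (by norm_num)
  rw [contMDiffAt_totalSpace]
  refine ⟨hR, ?_⟩
  have hmain := (hr.mul hθ).prodMk_space ((((hθ.mul hr').neg).smul
    (contMDiffAt_coord_gradient g hF p)))
  refine hmain.congr_of_eventuallyEq ?_
  filter_upwards [(chartAt E p).open_source.mem_nhds (mem_chart_source E p)] with q hq
  refine (trivializationAt_prod_snd (z₀ := graphMap F p) (z := graphMap F q) hq _).trans ?_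
  refine Prod.ext rfl ?_
  have hlin := map_smul ((trivializationAt E (TangentSpace 𝓘(ℝ, E) (M := N)) p).linearMapAt ℝ q)
    (-((Real.sqrt (ρ (F q) ^ 2 + g.inner q (gradient g F q) (gradient g F q)))⁻¹ / ρ (F q)))
    (gradient g F q)
  rw [Trivialization.coe_linearMapAt_of_mem _ hq] at hlin
  exact hlin

theorem isUnitNormal_graphNormal [FiniteDimensional ℝ E] {ρ : ℝ → ℝ} (hρ : ContDiff ℝ ∞ ρ)
    (hpos : ∀ t, 0 < ρ t) (g : Metric 𝓘(ℝ, E) N) {F : N → ℝ}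
    (hF : ContMDiff 𝓘(ℝ, E) 𝓘(ℝ, ℝ) 2 F) :
    IsUnitNormal 𝓘(ℝ, E) (warpedMetric ρ hρ hpos g) (graphMap F) (graphNormal ρ g F) := by
  have hin : ∀ p (k : ℝ) (v : TangentSpace 𝓘(ℝ, E) p),
      g.inner p (-k • gradient g F p) v = -k * mvfderiv 𝓘(ℝ, E) F p v := fun p k v => by
    rw [map_smul, ← inner_gradient g]
    rfl
  refine ⟨contMDiff_graphNormal hρ hpos g hF, fun p => ?_, fun p v => ?_⟩
  · refine (warpedInner_apply ρ g _ _ _).trans ?_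
    set s := ρ (F p) ^ 2 + g.inner p (gradient g F p) (gradient g F p) with hs
    have hp := hpos (F p)
    have hs0 : 0 < s := by
      have := inner_self_nonneg g p (gradient g F p)
      positivity
    have hsq : Real.sqrt s ≠ 0 := (Real.sqrt_pos.2 hs0).ne'
    have h1 := hin p ((Real.sqrt s)⁻¹ / ρ (F p)) (-((Real.sqrt s)⁻¹ / ρ (F p)) • gradient g F p)
    have h3 : mvfderiv 𝓘(ℝ, E) F p (-((Real.sqrt s)⁻¹ / ρ (F p)) • gradient g F p) =
        -((Real.sqrt s)⁻¹ / ρ (F p)) * g.inner p (gradient g F p) (gradient g F p) := by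
      rw [map_smul, inner_gradient g, smul_eq_mul]
    change ρ (F p) * (Real.sqrt s)⁻¹ * (ρ (F p) * (Real.sqrt s)⁻¹) + ρ (F p) ^ 2 *
      g.inner p (-((Real.sqrt s)⁻¹ / ρ (F p)) • gradient g F p)
        (-((Real.sqrt s)⁻¹ / ρ (F p)) • gradient g F p) = 1
    rw [h1, h3]
    have h2 : Real.sqrt s ^ 2 = s := Real.sq_sqrt hs0.le
    field_simp
    rw [h2, hs]
  · rw [mfderiv_graphMap (hF.mdifferentiable (by simp) p)]
    refine (warpedInner_apply ρ g _ _ _).trans ?_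
    set s := ρ (F p) ^ 2 + g.inner p (gradient g F p) (gradient g F p) with hs
    have hp := hpos (F p)
    change ρ (F p) * (Real.sqrt s)⁻¹ * mvfderiv 𝓘(ℝ, E) F p v + ρ (F p) ^ 2 *
      g.inner p (-((Real.sqrt s)⁻¹ / ρ (F p)) • gradient g F p) v = 0
    rw [hin]
    field_simp
    ring

end Graph

/-! ### Shape operator of the graph for an arbitrary unit normal -/

section GraphShape

variable {E : Type*} [NormedAddCommGroup E] [NormedSpace ℝ E]
  {N : Type*} [TopologicalSpace N] [ChartedSpace E N] [IsManifold 𝓘(ℝ, E) ∞ N]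
  {ρ : ℝ → ℝ} {hρ : ContDiff ℝ ∞ ρ} {hpos : ∀ t, 0 < ρ t} {g : Metric 𝓘(ℝ, E) N} {F : N → ℝ}
  {ξ : ∀ p : N, TangentSpace (𝓘(ℝ, ℝ).prod 𝓘(ℝ, E)) (graphMap F p)}

theorem eventually_coordField_graphMap (p : N)
    (V : ∀ p : N, TangentSpace (𝓘(ℝ, ℝ).prod 𝓘(ℝ, E)) (graphMap F p)) :
    ∀ᶠ q in nhds p, coordField (𝓘(ℝ, ℝ).prod 𝓘(ℝ, E)) (graphMap F) p V q =
      ((V q).1, ((trivializationAt E (TangentSpace 𝓘(ℝ, E) (M := N)) p)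
        (⟨q, (V q).2⟩ : TangentBundle 𝓘(ℝ, E) N)).2) := by
  filter_upwards [(chartAt E p).open_source.mem_nhds (mem_chart_source E p)] with q hq
  exact trivializationAt_prod_snd (z₀ := graphMap F p) (z := graphMap F q) hq _

theorem IsUnitNormal.contMDiffAt_coordField
    (hξ : IsUnitNormal 𝓘(ℝ, E) (warpedMetric ρ hρ hpos g) (graphMap F) ξ) (p : N) :
    ContMDiffAt 𝓘(ℝ, E) 𝓘(ℝ, ℝ × E) 1
      (coordField (𝓘(ℝ, ℝ).prod 𝓘(ℝ, E)) (graphMap F) p ξ) p := by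
  have h := hξ.contMDiff p
  rw [contMDiffAt_totalSpace] at h
  exact h.2

theorem IsUnitNormal.contMDiffAt_fst
    (hξ : IsUnitNormal 𝓘(ℝ, E) (warpedMetric ρ hρ hpos g) (graphMap F) ξ) (p : N) :
    ContMDiffAt 𝓘(ℝ, E) 𝓘(ℝ, ℝ) 1 (fun q => ((ξ q).1 : ℝ)) p := by
  have h : ContMDiffAt 𝓘(ℝ, E) 𝓘(ℝ, ℝ) 1
      (fun q => (coordField (𝓘(ℝ, ℝ).prod 𝓘(ℝ, E)) (graphMap F) p ξ q).1) p :=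
    (contDiff_fst.contMDiff.contMDiffAt).comp p (hξ.contMDiffAt_coordField p)
  refine h.congr_of_eventuallyEq ?_
  filter_upwards [eventually_coordField_graphMap p ξ] with q hq
  rw [hq]

theorem IsUnitNormal.unit_apply
    (hξ : IsUnitNormal 𝓘(ℝ, E) (warpedMetric ρ hρ hpos g) (graphMap F) ξ) (p : N) :
    (ξ p).1 * (ξ p).1 + ρ (F p) ^ 2 * g.inner p (ξ p).2 (ξ p).2 = 1 :=
  hξ.unit p

theorem IsUnitNormal.normal_apply (hF : ContMDiff 𝓘(ℝ, E) 𝓘(ℝ, ℝ) 2 F)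
    (hξ : IsUnitNormal 𝓘(ℝ, E) (warpedMetric ρ hρ hpos g) (graphMap F) ξ) (p : N)
    (v : TangentSpace 𝓘(ℝ, E) p) :
    (ξ p).1 * mvfderiv 𝓘(ℝ, E) F p v + ρ (F p) ^ 2 * g.inner p (ξ p).2 v = 0 := by
  have h := hξ.normal p v
  rw [mfderiv_graphMap (hF.mdifferentiable (by simp) p)] at h
  exact h

/-- The coordinate vector field with components `v` in the chart at `p`, pushed to the graph. -/
def graphField (F : N → ℝ) (p : N) (v : E) (q : N) :
    TangentSpace (𝓘(ℝ, ℝ).prod 𝓘(ℝ, E)) (graphMap F q) :=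
  mfderiv 𝓘(ℝ, E) (𝓘(ℝ, ℝ).prod 𝓘(ℝ, E)) (graphMap F) q
    ((trivializationAt E (TangentSpace 𝓘(ℝ, E) (M := N)) p).symm q v)

/-- The N-component of the field is constant in the chart, so its derivative at p carries only the
coordinate Hessian of F. -/
theorem coordField_graphField (hF : ContMDiff 𝓘(ℝ, E) 𝓘(ℝ, ℝ) 2 F) (p : N) (v : E) :
    coordField (𝓘(ℝ, ℝ).prod 𝓘(ℝ, E)) (graphMap F) p (graphField F p v) =ᶠ[nhds p]
      fun q => (chartDifferential F p q v, v) := by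
  filter_upwards [eventually_coordField_graphMap p (graphField F p v),
    eventually_mem_baseSet (I := 𝓘(ℝ, E)) p] with q hq hq'
  have h0 := mfderiv_graphMap (hF.mdifferentiable (by simp) q)
    ((trivializationAt E (TangentSpace 𝓘(ℝ, E) (M := N)) p).symm q v)
  have h1 := (trivializationAt E (TangentSpace 𝓘(ℝ, E) (M := N)) p).apply_mk_symm hq' v
  have h2 := mvfderiv_eq_chartDifferential hF hq'
    ((trivializationAt E (TangentSpace 𝓘(ℝ, E) (M := N)) p).symm q v)
  rw [h1] at h2
  rw [hq]
  refine Prod.ext ((congrArg Prod.fst h0).trans h2) ?_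
  refine Eq.trans ?_ (congrArg Prod.snd h1 : _ = v)
  exact congrArg (fun w : E => ((trivializationAt E (TangentSpace 𝓘(ℝ, E) (M := N)) p)
    (⟨q, w⟩ : TangentBundle 𝓘(ℝ, E) N)).2) (congrArg Prod.snd h0)

theorem hasMFDerivAt_coordField_graphField (hF : ContMDiff 𝓘(ℝ, E) 𝓘(ℝ, ℝ) 2 F) (p : N) (v : E) :
    HasMFDerivAt 𝓘(ℝ, E) 𝓘(ℝ, ℝ × E)
      (coordField (𝓘(ℝ, ℝ).prod 𝓘(ℝ, E)) (graphMap F) p (graphField F p v)) p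
      ((mvfderiv 𝓘(ℝ, E) (fun q => chartDifferential (E := E) F p q v) p : E →L[ℝ] ℝ).prod 0) := by
  have h1 : MDifferentiableAt 𝓘(ℝ, E) 𝓘(ℝ, ℝ) (fun q => chartDifferential (E := E) F p q v) p :=
    ((contMDiffAt_chartDifferential hF p).clm_apply contMDiffAt_const).mdifferentiableAt (by simp)
  have h2 : HasMFDerivAt 𝓘(ℝ, E) 𝓘(ℝ, ℝ × E) (fun q => (chartDifferential (E := E) F p q v, v)) p
      ((mvfderiv 𝓘(ℝ, E) (fun q => chartDifferential (E := E) F p q v) p : E →L[ℝ] ℝ).prod 0) :=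
    ⟨h1.hasMFDerivAt.1.prodMk continuousAt_const,
      HasFDerivWithinAt.prodMk h1.hasMFDerivAt.2 (hasFDerivWithinAt_const v _ _)⟩
  exact h2.congr_of_eventuallyEq (coordField_graphField hF p v)

variable [FiniteDimensional ℝ E]

/-- Normality tested on η and on ∇F gives ρ⁴ g(η, η) = θ²|∇F|²; inserting this into the unit
condition leaves θ alone. No explicit form or sign of ξ is needed. -/
theorem IsUnitNormal.sq_fst (hF : ContMDiff 𝓘(ℝ, E) 𝓘(ℝ, ℝ) 2 F)
    (hξ : IsUnitNormal 𝓘(ℝ, E) (warpedMetric ρ hρ hpos g) (graphMap F) ξ) (p : N) :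
    (ξ p).1 ^ 2 * (ρ (F p) ^ 2 + length g p (gradient g F p) ^ 2) = ρ (F p) ^ 2 := by
  have h1 := hξ.unit_apply p
  have h2 := hξ.normal_apply hF p (ξ p).2
  have h3 := hξ.normal_apply hF p (gradient g F p)
  rw [length, Real.sq_sqrt (inner_self_nonneg g p _)]
  have h4 : g.inner p (ξ p).2 (gradient g F p) = mvfderiv 𝓘(ℝ, E) F p (ξ p).2 :=
    (g.symm p _ _).trans (inner_gradient g F p _)
  rw [h4, ← inner_gradient g F p (gradient g F p)] at h3
  linear_combination (ρ (F p) ^ 2) * h1 - ρ (F p) ^ 2 * h2 + (ξ p).1 * h3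

/-- The angle function `⟨ξ, ∂_t⟩` of the graph of a transnormal function is stationary along
the level sets. -/
theorem IsUnitNormal.mvfderiv_fst_eq_zero (hF : ContMDiff 𝓘(ℝ, E) 𝓘(ℝ, ℝ) 2 F)
    (hT : IsTransnormal g F)
    (hξ : IsUnitNormal 𝓘(ℝ, E) (warpedMetric ρ hρ hpos g) (graphMap F) ξ) (p : N)
    (hd : mvfderiv 𝓘(ℝ, E) F p ≠ 0) (v : TangentSpace 𝓘(ℝ, E) p)
    (hv : mvfderiv 𝓘(ℝ, E) F p v = 0) :
    mvfderiv 𝓘(ℝ, E) (fun q => ((ξ q).1 : ℝ)) p v = 0 := by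
  obtain ⟨b, -, hb⟩ := hT
  have hθ := hξ.contMDiffAt_fst p
  -- The sign of θ is not determined by F, so the argument runs through θ², which is determined, and
  -- divides by θ at the end.
  have hsq : ∀ q, (ξ q).1 * (ξ q).1 = ρ (F q) ^ 2 / (ρ (F q) ^ 2 + b (F q) ^ 2) := fun q => by
    have h1 := hξ.sq_fst hF q
    rw [hb] at h1
    have h2 := hpos (F q)
    rw [eq_div_iff (by positivity), ← sq, h1]
  have h1 := mvfderiv_eq_zero_of_eq_comp (ψ := fun q => ((ξ q).1 : ℝ) * (ξ q).1)
    (hF.contMDiffAt.of_le (by norm_num)) (hθ.mul hθ)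
    (fun q hq => by rw [hsq, hsq, hq]) hd v hv
  have hθ0 : (ξ p).1 ≠ 0 := by
    intro h0
    have h2 := hξ.sq_fst hF p
    have h3 := hpos (F p)
    rw [h0, zero_pow two_ne_zero, zero_mul] at h2
    exact (pow_pos h3 2).ne h2
  have hθd : MDifferentiableAt 𝓘(ℝ, E) 𝓘(ℝ, ℝ) (fun q => ((ξ q).1 : ℝ)) p :=
    hθ.mdifferentiableAt (by simp)
  rw [mvfderiv_fun_mul hθd hθd] at h1
  have h2 : (ξ p).1 * mvfderiv 𝓘(ℝ, E) (fun q => ((ξ q).1 : ℝ)) p v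
    + (ξ p).1 * mvfderiv 𝓘(ℝ, E) (fun q => ((ξ q).1 : ℝ)) p v = 0 := h1
  have h3 : (ξ p).1 * mvfderiv 𝓘(ℝ, E) (fun q => ((ξ q).1 : ℝ)) p v = 0 := by linarith
  exact (mul_eq_zero.1 h3).resolve_left hθ0

/-- Differentiate ⟨ξ, ξ⟩ = 1. -/
theorem IsUnitNormal.inner_covDerivAlong_self (hF : ContMDiff 𝓘(ℝ, E) 𝓘(ℝ, ℝ) 2 F)
    (hξ : IsUnitNormal 𝓘(ℝ, E) (warpedMetric ρ hρ hpos g) (graphMap F) ξ) (p : N)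
    (v : TangentSpace 𝓘(ℝ, E) p) :
    (warpedMetric ρ hρ hpos g).inner (graphMap F p)
      (covDerivAlong 𝓘(ℝ, E) (warpedMetric ρ hρ hpos g) (graphMap F) ξ p v) (ξ p) = 0 := by
  have hξd := (hξ.contMDiffAt_coordField p).mdifferentiableAt (by simp)
  have h := mvfderiv_inner_along (warpedMetric ρ hρ hpos g)
    ((contMDiff_graphMap hF).mdifferentiable (by simp) p) ξ ξ hξd hξd v
  rw [show (fun q => (warpedMetric ρ hρ hpos g).inner (graphMap F q) (ξ q) (ξ q)) = fun _ => 1 from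
    funext hξ.unit, mvfderiv_const, (warpedMetric ρ hρ hpos g).symm _ (ξ p)] at h
  have h0 : (0 : TangentSpace 𝓘(ℝ, E) p →L[ℝ] ℝ) v = 0 := rfl
  rw [h0] at h
  linarith

/-- Differentiate θ = ⟨ξ, ∂_t⟩. The other term ⟨ξ, ∇_v ∂_t⟩ is ρρ' g(v, η), and normality gives g(η,
v) = 0 when dF(v) = 0. -/
theorem IsUnitNormal.inner_covDerivAlong_partialT (hF : ContMDiff 𝓘(ℝ, E) 𝓘(ℝ, ℝ) 2 F)
    (hξ : IsUnitNormal 𝓘(ℝ, E) (warpedMetric ρ hρ hpos g) (graphMap F) ξ) (p : N)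
    (v : TangentSpace 𝓘(ℝ, E) p) (hv : mvfderiv 𝓘(ℝ, E) F p v = 0) :
    (warpedMetric ρ hρ hpos g).inner (graphMap F p)
      (covDerivAlong 𝓘(ℝ, E) (warpedMetric ρ hρ hpos g) (graphMap F) ξ p v)
      (partialT (E := E) N (graphMap F p)) = mvfderiv 𝓘(ℝ, E) (fun q => ((ξ q).1 : ℝ)) p v := by
  have hξd := (hξ.contMDiffAt_coordField p).mdifferentiableAt (by simp)
  have hX : coordField (𝓘(ℝ, ℝ).prod 𝓘(ℝ, E)) (graphMap F) p (fun q => partialT (E := E) N (graphMap F q))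
      =ᶠ[nhds p] fun _ => ((1 : ℝ), (0 : E)) := by
    filter_upwards [eventually_coordField_graphMap p (fun q => partialT (E := E) N (graphMap F q)),
      eventually_mem_baseSet (I := 𝓘(ℝ, E)) p] with q hq hq'
    rw [hq]
    refine Prod.ext rfl ?_
    have hlin := map_zero
      ((trivializationAt E (TangentSpace 𝓘(ℝ, E) (M := N)) p).linearMapAt ℝ q)
    rw [Trivialization.coe_linearMapAt_of_mem _ hq'] at hlin
    exact hlin
  have hXd : HasMFDerivAt 𝓘(ℝ, E) 𝓘(ℝ, ℝ × E)
      (coordField (𝓘(ℝ, ℝ).prod 𝓘(ℝ, E)) (graphMap F) p (fun q => partialT (E := E) N (graphMap F q))) p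
      (0 : E →L[ℝ] ℝ × E) :=
    (hasMFDerivAt_const (I := 𝓘(ℝ, E)) (I' := 𝓘(ℝ, ℝ × E)) ((1 : ℝ), (0 : E)) p).congr_of_eventuallyEq
      hX
  have h := mvfderiv_inner_along (warpedMetric ρ hρ hpos g)
    ((contMDiff_graphMap hF).mdifferentiable (by simp) p) ξ (fun q => partialT (E := E) N (graphMap F q)) hξd
    hXd.mdifferentiableAt v
  have h1 : (fun q => (warpedMetric ρ hρ hpos g).inner (graphMap F q) (ξ q)
      (partialT (E := E) N (graphMap F q))) = fun q => ((ξ q).1 : ℝ) := by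
    funext q
    refine (warpedInner_apply ρ g _ _ _).trans ?_
    have : g.inner q (ξ q).2 (0 : TangentSpace 𝓘(ℝ, E) q) = 0 := map_zero _
    change (ξ q).1 * 1 + ρ (F q) ^ 2 * g.inner q (ξ q).2 (0 : TangentSpace 𝓘(ℝ, E) q) = _
    rw [this]
    ring
  have h2 : (warpedMetric ρ hρ hpos g).inner (graphMap F p) (ξ p)
      (covDerivAlong 𝓘(ℝ, E) (warpedMetric ρ hρ hpos g) (graphMap F)
        (fun q => partialT (E := E) N (graphMap F q)) p v) = 0 := by
    rw [(warpedMetric ρ hρ hpos g).symm, inner_covDerivAlong]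
    have e1 : mvfderiv 𝓘(ℝ, E) (coordField (𝓘(ℝ, ℝ).prod 𝓘(ℝ, E)) (graphMap F) p
        (fun q => partialT (E := E) N (graphMap F q))) p v = 0 :=
      congrArg (fun L : E →L[ℝ] ℝ × E => L v) hXd.mfderiv
    rw [e1, ContinuousLinearMap.map_zero, mfderiv_graphMap (hF.mdifferentiable (by simp) p)]
    have e2 := christoffelFirst_warpedMetric_partialT ρ hρ hpos g (graphMap F p)
      (mvfderiv 𝓘(ℝ, E) F p v, v) (ξ p)
    have e3 := hξ.normal_apply hF p v
    rw [hv, mul_zero, zero_add] at e3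
    have e4 : coordMetric g p p v (ξ p).2 = 0 :=
      ((coordMetric_self g p v _).trans (g.symm p v _)).trans
        ((mul_eq_zero.1 e3).resolve_left (pow_ne_zero 2 (hpos _).ne'))
    have e5 := e2.trans (congrArg (fun r => ρ (F p) * deriv ρ (F p) * r) e4)
    refine (congrArg₂ (· + ·) rfl e5).trans ?_
    change (0 : ℝ) + _ * 0 = 0
    ring
  rw [h1] at h
  rw [h, h2, add_zero]

/-- The shape operator of a graph is symmetric. -/
theorem IsUnitNormal.inner_covDerivAlong_symm (hF : ContMDiff 𝓘(ℝ, E) 𝓘(ℝ, ℝ) 2 F)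
    (hξ : IsUnitNormal 𝓘(ℝ, E) (warpedMetric ρ hρ hpos g) (graphMap F) ξ) (p : N)
    (u v : TangentSpace 𝓘(ℝ, E) p) :
    (warpedMetric ρ hρ hpos g).inner (graphMap F p)
      (covDerivAlong 𝓘(ℝ, E) (warpedMetric ρ hρ hpos g) (graphMap F) ξ p u)
      (mfderiv 𝓘(ℝ, E) (𝓘(ℝ, ℝ).prod 𝓘(ℝ, E)) (graphMap F) p v) =
    (warpedMetric ρ hρ hpos g).inner (graphMap F p)
      (covDerivAlong 𝓘(ℝ, E) (warpedMetric ρ hρ hpos g) (graphMap F) ξ p v)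
      (mfderiv 𝓘(ℝ, E) (𝓘(ℝ, ℝ).prod 𝓘(ℝ, E)) (graphMap F) p u) := by
  have hξd := (hξ.contMDiffAt_coordField p).mdifferentiableAt (by simp)
  -- Differentiate ⟨ξ, W⟩ = 0 along u, where W is the pushed-forward constant-coefficient field of
  -- v. The result is symmetric in u and v: a Hessian term and a Christoffel term.
  have key : ∀ u v : TangentSpace 𝓘(ℝ, E) p, (warpedMetric ρ hρ hpos g).inner (graphMap F p)
      (covDerivAlong 𝓘(ℝ, E) (warpedMetric ρ hρ hpos g) (graphMap F) ξ p u)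
      (mfderiv 𝓘(ℝ, E) (𝓘(ℝ, ℝ).prod 𝓘(ℝ, E)) (graphMap F) p v) =
      -(coordMetric (warpedMetric ρ hρ hpos g) (graphMap F p) (graphMap F p)
        (mvfderiv 𝓘(ℝ, E) (fun q => chartDifferential (E := E) F p q v) p u, 0) (ξ p)
        + christoffelFirst (warpedMetric ρ hρ hpos g) (graphMap F p)
          (mfderiv 𝓘(ℝ, E) (𝓘(ℝ, ℝ).prod 𝓘(ℝ, E)) (graphMap F) p u)
          (mfderiv 𝓘(ℝ, E) (𝓘(ℝ, ℝ).prod 𝓘(ℝ, E)) (graphMap F) p v) (ξ p)) := fun u v => by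
    have hW := hasMFDerivAt_coordField_graphField hF p v
    have h := mvfderiv_inner_along (warpedMetric ρ hρ hpos g)
      ((contMDiff_graphMap hF).mdifferentiable (by simp) p) ξ (graphField (E := E) F p v) hξd
      hW.mdifferentiableAt u
    rw [show (fun q => (warpedMetric ρ hρ hpos g).inner (graphMap F q) (ξ q) (graphField (E := E) F p v q))
      = fun _ => 0 from funext fun q => hξ.normal q _, mvfderiv_const,
      (warpedMetric ρ hρ hpos g).symm _ (ξ p), inner_covDerivAlong _ _ (graphField (E := E) F p v)] at h
    have h0 : (0 : TangentSpace 𝓘(ℝ, E) p →L[ℝ] ℝ) u = 0 := rfl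
    have h1 : graphField (E := E) F p v p =
        mfderiv 𝓘(ℝ, E) (𝓘(ℝ, ℝ).prod 𝓘(ℝ, E)) (graphMap F) p v :=
      congrArg (fun w : E => mfderiv 𝓘(ℝ, E) (𝓘(ℝ, ℝ).prod 𝓘(ℝ, E)) (graphMap F) p w)
        (trivializationAt_self_symm (E := E) p v)
    have h2 : mvfderiv 𝓘(ℝ, E) (coordField (𝓘(ℝ, ℝ).prod 𝓘(ℝ, E)) (graphMap F) p
        (graphField (E := E) F p v)) p u =
        (mvfderiv 𝓘(ℝ, E) (fun q => chartDifferential (E := E) F p q v) p u, 0) :=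
      congrArg (fun L : E →L[ℝ] ℝ × E => L u) hW.mfderiv
    rw [h0, h1, h2] at h
    exact eq_neg_of_add_eq_zero_left h.symm
  rw [key, key]
  refine congrArg Neg.neg (congrArg₂ (· + ·) ?_ (christoffelFirst_symm _ _ _ _ _))
  exact congrArg (fun r : ℝ => coordMetric (warpedMetric ρ hρ hpos g) (graphMap F p) (graphMap F p)
    (r, 0) (ξ p)) (mvfderiv_chartDifferential_symm hF p u v)

end GraphShape

/-! ### The tangential projection of ∂_t is an eigenvector -/

section GraphPrincipal

variable {E : Type*} [NormedAddCommGroup E] [NormedSpace ℝ E]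
  {N : Type*} [TopologicalSpace N] [ChartedSpace E N] [IsManifold 𝓘(ℝ, E) ∞ N]
  {ρ : ℝ → ℝ} {hρ : ContDiff ℝ ∞ ρ} {hpos : ∀ t, 0 < ρ t} {g : Metric 𝓘(ℝ, E) N} {F : N → ℝ}
  {ξ : ∀ p : N, TangentSpace (𝓘(ℝ, ℝ).prod 𝓘(ℝ, E)) (graphMap F p)}

theorem tangentPart_partialT (p : N) :
    tangentPart (warpedMetric ρ hρ hpos g) (graphMap F) ξ (partialT N) p =
      ((1 - (ξ p).1 * (ξ p).1, -((ξ p).1 • (ξ p).2)) : ℝ × E) := by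
  have h : (warpedMetric ρ hρ hpos g).inner (graphMap F p) (partialT (E := E) N (graphMap F p))
      (ξ p) = (ξ p).1 := by
    refine (warpedInner_apply ρ g _ _ _).trans ?_
    have : g.inner p (0 : TangentSpace 𝓘(ℝ, E) p) = 0 := map_zero _
    change 1 * (ξ p).1 + ρ (F p) ^ 2 * g.inner p (0 : TangentSpace 𝓘(ℝ, E) p) (ξ p).2 = _
    rw [this]
    change 1 * (ξ p).1 + ρ (F p) ^ 2 * 0 = _
    ring
  rw [tangentPart, h]
  refine Prod.ext rfl ?_
  exact zero_sub ((ξ p).1 • (ξ p).2 : E)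

variable [FiniteDimensional ℝ E] in
theorem isPrincipalDirection_tangentPart (hF : ContMDiff 𝓘(ℝ, E) 𝓘(ℝ, ℝ) 2 F)
    (hT : IsTransnormal g F)
    (hξ : IsUnitNormal 𝓘(ℝ, E) (warpedMetric ρ hρ hpos g) (graphMap F) ξ) (p : N)
    (hw : tangentPart (warpedMetric ρ hρ hpos g) (graphMap F) ξ (partialT N) p ≠ 0) :
    IsPrincipalDirection 𝓘(ℝ, E) (warpedMetric ρ hρ hpos g) (graphMap F) ξ p
      (tangentPart (warpedMetric ρ hρ hpos g) (graphMap F) ξ (partialT N) p) := by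
  let η : TangentSpace 𝓘(ℝ, E) p := (ξ p).2
  let θ : ℝ := (ξ p).1
  have hr := hpos (F p)
  have hunit : θ * θ + ρ (F p) ^ 2 * g.inner p η η = 1 := hξ.unit_apply p
  have hnormal : ∀ v : TangentSpace 𝓘(ℝ, E) p,
      θ * mvfderiv 𝓘(ℝ, E) F p v + ρ (F p) ^ 2 * g.inner p η v = 0 := hξ.normal_apply hF p
  have hθ : θ ≠ 0 := by
    intro h0
    have h1 := hξ.sq_fst hF p
    rw [show (ξ p).1 = 0 from h0, zero_pow two_ne_zero, zero_mul] at h1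
    exact (pow_pos hr 2).ne h1
  -- If η = 0, then θ² = 1 and ξ is ±∂_t, which has no tangential projection.
  have hη : η ≠ 0 := by
    intro h0
    apply hw
    rw [tangentPart_partialT]
    rw [h0, map_zero, mul_zero, add_zero] at hunit
    refine Prod.ext (sub_eq_zero.2 hunit.symm) ?_
    change -(θ • (η : E)) = 0
    rw [show (η : E) = 0 from h0, smul_zero, neg_zero]
  have hdη : mvfderiv 𝓘(ℝ, E) F p η ≠ 0 := by
    intro h0
    have h1 := hnormal η
    rw [h0, mul_zero, zero_add] at h1
    exact (mul_pos (pow_pos hr 2) (g.pos p η hη)).ne' h1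
  have hd : mvfderiv 𝓘(ℝ, E) F p ≠ 0 := fun h => hdη (by rw [h]; rfl)
  -- Forced: the differential of the graph map keeps u as its N-component, and that of the
  -- tangential projection is -θη.
  let u : TangentSpace 𝓘(ℝ, E) p := -(θ • η)
  have hu : mfderiv 𝓘(ℝ, E) (𝓘(ℝ, ℝ).prod 𝓘(ℝ, E)) (graphMap F) p u =
      tangentPart (warpedMetric ρ hρ hpos g) (graphMap F) ξ (partialT N) p := by
    rw [tangentPart_partialT, mfderiv_graphMap (hF.mdifferentiable (by simp) p)]
    refine Prod.ext ?_ rfl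
    have h1 : mvfderiv 𝓘(ℝ, E) F p u = -(θ * mvfderiv 𝓘(ℝ, E) F p η) := by
      rw [map_neg, map_smul, smul_eq_mul]
    refine h1.trans ?_
    change _ = 1 - θ * θ
    linarith [hnormal η]
  let A : TangentSpace (𝓘(ℝ, ℝ).prod 𝓘(ℝ, E)) (graphMap F p) :=
    covDerivAlong 𝓘(ℝ, E) (warpedMetric ρ hρ hpos g) (graphMap F) ξ p u
  let a : TangentSpace 𝓘(ℝ, E) p := A.2
  have hAξ : A.1 * θ + ρ (F p) ^ 2 * g.inner p a η = 0 := hξ.inner_covDerivAlong_self hF p u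
  -- Symmetry moves the derivative onto v, where stationarity of θ along ker dF applies.
  have hker : ∀ v : TangentSpace 𝓘(ℝ, E) p, mvfderiv 𝓘(ℝ, E) F p v = 0 → g.inner p a v = 0 := by
    intro v hv
    have h1 := hξ.inner_covDerivAlong_symm hF p u v
    have h2 : (warpedMetric ρ hρ hpos g).inner (graphMap F p) A
        (mfderiv 𝓘(ℝ, E) (𝓘(ℝ, ℝ).prod 𝓘(ℝ, E)) (graphMap F) p v) =
        A.1 * mvfderiv 𝓘(ℝ, E) F p v + ρ (F p) ^ 2 * g.inner p a v := by
      rw [mfderiv_graphMap (hF.mdifferentiable (by simp) p)]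
      rfl
    have h3 : (warpedMetric ρ hρ hpos g).inner (graphMap F p)
        (covDerivAlong 𝓘(ℝ, E) (warpedMetric ρ hρ hpos g) (graphMap F) ξ p v)
        (mfderiv 𝓘(ℝ, E) (𝓘(ℝ, ℝ).prod 𝓘(ℝ, E)) (graphMap F) p u) = 0 := by
      rw [hu, tangentPart, map_sub, map_smul, hξ.inner_covDerivAlong_self hF,
        hξ.inner_covDerivAlong_partialT hF p v hv, hξ.mvfderiv_fst_eq_zero hF hT p hd v hv,
        smul_zero, sub_zero]
    have h4 := h2.symm.trans (h1.trans h3)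
    rw [hv, mul_zero, zero_add] at h4
    exact (mul_eq_zero.1 h4).resolve_left (pow_pos hr 2).ne'
  let k : ℝ := g.inner p a η / g.inner p η η
  have hηη : g.inner p η η ≠ 0 := (g.pos p η hη).ne'
  have ha : a = k • η := by
    have hz : ∀ v : TangentSpace 𝓘(ℝ, E) p, g.inner p (a - k • η) v = 0 := by
      intro v
      have e : g.inner p (a - k • η) v = g.inner p a v - k * g.inner p η v := by
        rw [map_sub, map_smul]
        rfl
      -- Subtracting a multiple of η, which is transverse to ker dF, brings v into ker dF.
      have h1 := hker (v - (mvfderiv 𝓘(ℝ, E) F p v / mvfderiv 𝓘(ℝ, E) F p η) • η) (by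
        rw [map_sub, map_smul, smul_eq_mul, div_mul_cancel₀ _ hdη, sub_self])
      rw [map_sub, map_smul, smul_eq_mul, sub_eq_zero] at h1
      have h2 := hnormal v
      have h3 := hnormal η
      have h4 : mvfderiv 𝓘(ℝ, E) F p v * g.inner p η η = mvfderiv 𝓘(ℝ, E) F p η * g.inner p η v := by
        have h5 : θ * (mvfderiv 𝓘(ℝ, E) F p v * g.inner p η η -
            mvfderiv 𝓘(ℝ, E) F p η * g.inner p η v) = 0 := by
          linear_combination g.inner p η η * h2 - g.inner p η v * h3
        exact sub_eq_zero.1 ((mul_eq_zero.1 h5).resolve_left hθ)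
      rw [e, h1, sub_eq_zero]
      simp only [k]
      field_simp
      linear_combination g.inner p a η * h4
    by_contra hne
    exact (g.pos p _ (sub_ne_zero.2 hne)).ne' (hz _)
  -- With a = kη, comparing -a with the N-component -θη forces the eigenvalue k/θ.
  refine ⟨hw, u, hu, k / θ, ?_⟩
  rw [tangentPart_partialT]
  -- The ℝ-component is not free: ⟨∇_u ξ, ξ⟩ = 0 determines it from a, since θ ≠ 0.
  have hA1 : -A.1 = k / θ * (1 - θ * θ) := by
    have h1 : g.inner p a η = k * g.inner p η η := (div_mul_cancel₀ _ hηη).symm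
    rw [h1] at hAξ
    field_simp
    linear_combination -hAξ + k * hunit
  refine Prod.ext hA1 ?_
  change -(a : E) = (k / θ) • -(θ • (η : E))
  rw [show (a : E) = k • (η : E) from ha, smul_neg, smul_smul, div_mul_cancel₀ _ hθ]

end GraphPrincipal

end CanonicalDirection

end

theorem mainTheorem2 {E : Type*} [NormedAddCommGroup E] [NormedSpace ℝ E] [FiniteDimensional ℝ E]
    {N : Type*} [TopologicalSpace N] [ChartedSpace E N] [IsManifold 𝓘(ℝ, E) ∞ N]
    (g : CanonicalDirection.Metric 𝓘(ℝ, E) N)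
    (ρ : ℝ → ℝ) (hρ : ContDiff ℝ ∞ ρ) (hpos : ∀ t, 0 < ρ t)
    (F : N → ℝ) (hF : ContMDiff 𝓘(ℝ, E) 𝓘(ℝ, ℝ) 2 F)
    (hT : CanonicalDirection.IsTransnormal g F) :
    CanonicalDirection.HasCanonicalPrincipalDirection 𝓘(ℝ, E)
      (CanonicalDirection.warpedMetric ρ hρ hpos g) (CanonicalDirection.graphMap F)
      (CanonicalDirection.partialT N) :=
  ⟨CanonicalDirection.isHypersurface_graphMap hF,
    ⟨_, CanonicalDirection.isUnitNormal_graphNormal hρ hpos g hF⟩,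
    fun _ hξ p hw => CanonicalDirection.isPrincipalDirection_tangentPart hF hT hξ p hw⟩
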